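/- Let $\Gamma=\Gamma_0\supset\Gamma_1\supset\Gamma_2\supset\cdots$ be subgroups of $\mathrm{PSL}(2,\mathbb R)$, where $\Gamma_0$ is discrete, torsion-free and of finite covolume and each $\Gamma_{n+1}$ has finite index in $\Gamma_n$ (no normality is assumed), so that $S_n=\Gamma_n\backslash\mathbb H$ is a tower of finite coverings of the finite-area hyperbolic surface $S=S_0$. Put $T^1S_n=\Gamma_n\backslash\mathrm{PSL}(2,\mathbb R)$ and $\mathcal Y=\varprojlim T^1S_n$, with projection $\pi:\mathcal Y\to T^1S$. The horocycle flow $h_s$ and the geodesic flow $g_t$ on $T^1S_n$ and on $\mathcal Y$ are given by right multiplication by $\begin{pmatrix}1&s\\0&1\end{pmatrix}$ and by $\mathrm{diag}(e^{t/2},e^{-t/2})$. A cusp of $S_n$ is a $\Gamma_n$-orbit of points of $\partial\mathbb H$ fixed by parabolic elements of $\Gamma_n$; $\widehat{T^1S_n}$ is obtained from $T^1S_n$ by adding one point for each cusp, whose neighbourhoods are the sets containing it and the unit tangent vectors based in some horoball at the cusp. Let $\widehat{\mathcal Y}=\varprojlim\widehat{T^1S_n}\supset\mathcal Y$. A point of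 $\widehat{\mathcal Y}-\mathcal Y$ is thus a sequence $\xi=(\xi_n)$ of cusps $\xi_n$ of $S_n$, each $\xi_{n+1}$ projecting to $\xi_n$. We say that $x=(x_n)\in\mathcal Y$ corresponds to $\xi$ if, for every $n$, $x_n=\Gamma_n u_n$ for some $u_n\in\mathrm{PSL}(2,\mathbb R)$ such that $u_n(\infty)\in\partial\mathbb H$ represents $\xi_n$. A minimal set over a closed horocycle of period $\ell>0$ is a compact set $\mathcal M\subset\mathcal Y$ that is minimal for the horocycle flow and such that $\pi(\mathcal M)$ is a periodic horocyclic orbit of least period $\ell$ in $T^1S$. **Proposition 6.2.** 1. There is a bijection $\xi\mapsto\mathcal M_\xi$ from $\widehat{\mathcal Y}-\mathcal Y$ onto the set of minimal sets over closed horocycles of period $1$, where $\mathcal M_\xi$ is the set of all $x\in\mathcal Y$ that correspond to $\xi$ and for which $\pi(x)$ is periodic of least period $1$ under the horocycle flow. 2. Equivalently, $\xi\mapsto\mathcal F_\xi=\{g_t(\mathcal M_\xi):t\in\mathbb R\}$ is a bijection from $\widehat{\mathcal Y}-\mathcal Y$ onto the set of families $\{g_t(\mathcal M):t\in\mathbb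 R\}$, where $\mathcal M$ is a minimal set over a closed horocycle (of any period). For each $\xi$ the map $t\mapsto g_t(\mathcal M_\xi)$ is injective, $\mathcal F_\xi$ consists of exactly those minimal sets over closed horocycles all of whose points correspond to $\xi$, and for every point $x$ of a member of $\mathcal F_\xi$ one has $g_t(x)\to\xi$ in $\widehat{\mathcal Y}$ as $t\to+\infty$. 3. Every minimal set $\mathcal M$ over a closed horocycle of period $\ell$ is the suspension, with constant return time $\ell$, of a minimal odometer: there are finite sets $F_n$, bijections $T_n:F_n\to F_n$ and surjections $q_n:F_{n+1}\to F_n$ with $T_nq_n=q_nT_{n+1}$, such that the induced homeomorphism $T$ of $Z=\varprojlim F_n$ is minimal and the horocycle flow on $\mathcal M$ is conjugate, by a homeomorphism, to the flow $[z,s]\mapsto[z,s+t]$ on $(Z\times\mathbb R)/\big((z,s+\ell)\sim(Tz,s)\big)$. Moreover, the $F_n$ can be chosen so that either their cardinalities are strictly increasing (so $Z$ is a Cantor set and $T$ an odometer in the strict sense), or their cardinalities are bounded and $\mathcal M$ is a single closed horocyclic orbit. -/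

import Mathlib

open scoped MatrixGroups LinearAlgebra.Projectivization Topology

noncomputable section

namespace HorocycleSolenoid

/-! ### The group `PSL(2, ℝ)` and its one-parameter subgroups -/

/-- The unipotent matrix `(1 s; 0 1)`. -/
def unipotent (s : ℝ) : SL(2, ℝ) := ⟨!![1, s; 0, 1], by simp⟩

/-- The diagonal matrix `diag (e^{t/2}, e^{-t/2})`. -/
def diagonal (t : ℝ) : SL(2, ℝ) :=
  ⟨!![Real.exp (t / 2), 0; 0, Real.exp (-(t / 2))], by
    simp [← Real.exp_add]⟩

/-! ### The unit tangent bundle `Γ \ PSL(2, ℝ)` with its flows -/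

/-- `T¹S = Γ \ PSL(2, ℝ)`, the space of cosets `Γ g`, with the quotient topology. -/
def UnitTangent (Γ : Subgroup PSL(2, ℝ)) : Type := Quotient (QuotientGroup.rightRel Γ)

instance (Γ : Subgroup PSL(2, ℝ)) : TopologicalSpace (UnitTangent Γ) :=
  inferInstanceAs (TopologicalSpace (Quotient (QuotientGroup.rightRel Γ)))

namespace UnitTangent

variable {Γ Γ' : Subgroup PSL(2, ℝ)}

/-- The coset `Γ g`. -/
def mk (Γ : Subgroup PSL(2, ℝ)) (g : PSL(2, ℝ)) : UnitTangent Γ :=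
  Quotient.mk (QuotientGroup.rightRel Γ) g

/-- Right translation `Γ g ↦ Γ g a`. -/
def translate (a : PSL(2, ℝ)) : UnitTangent Γ → UnitTangent Γ :=
  Quotient.map (· * a) (by
    intro g g' h
    change QuotientGroup.rightRel Γ _ _ at h
    change QuotientGroup.rightRel Γ _ _
    rw [QuotientGroup.rightRel_apply] at h ⊢
    simpa [mul_assoc] using h)

/-- The horocycle flow `h_s (Γ g) = Γ g (1 s; 0 1)`. -/
def horocycle (s : ℝ) : UnitTangent Γ → UnitTangent Γ := translate (unipotent s : PSL(2, ℝ))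

/-- The geodesic flow `g_t (Γ g) = Γ g diag (e^{t/2}, e^{-t/2})`. -/
def geodesic (t : ℝ) : UnitTangent Γ → UnitTangent Γ := translate (diagonal t : PSL(2, ℝ))

/-- The covering `Γ' g ↦ Γ g` for `Γ' ≤ Γ`. -/
def cover (h : Γ' ≤ Γ) : UnitTangent Γ' → UnitTangent Γ :=
  Quotient.map id (by
    intro g g' hg
    change QuotientGroup.rightRel Γ' _ _ at hg
    change QuotientGroup.rightRel Γ _ _
    rw [QuotientGroup.rightRel_apply] at hg ⊢
    exact h hg)

theorem cover_translate (h : Γ' ≤ Γ) (a : PSL(2, ℝ)) (x : UnitTangent Γ') :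
    cover h (translate a x) = translate a (cover h x) := by
  induction x using Quotient.inductionOn with
  | _ g => rfl

/-- `x` is periodic for the horocycle flow, with (least) period `ℓ`. -/
def HasPeriod (x : UnitTangent Γ) (ℓ : ℝ) : Prop :=
  0 < ℓ ∧ horocycle ℓ x = x ∧ ∀ s, 0 < s → s < ℓ → horocycle s x ≠ x

end UnitTangent

/-! ### Cusps and the compactification of the unit tangent bundle -/

/-- The circle at infinity of the hyperbolic plane, as the real projective line. -/
abbrev Boundary : Type := ℙ ℝ (Fin 2 → ℝ)

/-- The point `∞ = [1 : 0]` at infinity of the upper half-plane. -/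
def infty : Boundary := Projectivization.mk ℝ ![1, 0] (by simp)

/-- `c` is fixed by some parabolic element of `Γ`. -/
def IsParabolicPoint (Γ : Subgroup PSL(2, ℝ)) (c : Boundary) : Prop :=
  ∃ A : SL(2, ℝ), (A : PSL(2, ℝ)) ∈ Γ ∧ (A : Matrix (Fin 2) (Fin 2) ℝ).IsParabolic ∧
    (A : PSL(2, ℝ)) • c = c

/-- Two parabolic points are equivalent when they lie in the same `Γ`-orbit. -/
def cuspSetoid (Γ : Subgroup PSL(2, ℝ)) : Setoid {c : Boundary // IsParabolicPoint Γ c} where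
  r c c' := ∃ γ ∈ Γ, γ • (c : Boundary) = c'
  iseqv :=
    { refl := fun c => ⟨1, Γ.one_mem, one_smul _ _⟩
      symm := by
        rintro c c' ⟨γ, hγ, h⟩
        exact ⟨γ⁻¹, Γ.inv_mem hγ, by rw [← h, inv_smul_smul]⟩
      trans := by
        rintro c c' c'' ⟨γ, hγ, h⟩ ⟨δ, hδ, h'⟩
        exact ⟨δ * γ, Γ.mul_mem hδ hγ, by rw [mul_smul, h, h']⟩ }

/-- The cusps of `Γ \ ℍ`: the `Γ`-orbits of points at infinity fixed by parabolic elements of `Γ`. -/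
def Cusp (Γ : Subgroup PSL(2, ℝ)) : Type := Quotient (cuspSetoid Γ)

namespace Cusp

variable {Γ Γ' : Subgroup PSL(2, ℝ)}

/-- The cusp determined by a parabolic point. -/
def mk (c : Boundary) (hc : IsParabolicPoint Γ c) : Cusp Γ :=
  Quotient.mk (cuspSetoid Γ) ⟨c, hc⟩

/-- The map induced on cusps by the covering `Γ' \ ℍ → Γ \ ℍ`, for `Γ' ≤ Γ`. -/
def cover (h : Γ' ≤ Γ) : Cusp Γ' → Cusp Γ :=
  Quotient.map
    (fun c => ⟨c.1, by
      obtain ⟨A, hA, hp, hc⟩ := c.2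
      exact ⟨A, h hA, hp, hc⟩⟩)
    (by
      rintro c c' ⟨γ, hγ, hc⟩
      exact ⟨γ, h hγ, hc⟩)

end Cusp

/-- The compactification of `T¹S = Γ \ PSL(2, ℝ)`, with one additional point for each cusp. -/
inductive Compactification (Γ : Subgroup PSL(2, ℝ)) : Type
  | point (x : UnitTangent Γ) : Compactification Γ
  | cusp (κ : Cusp Γ) : Compactification Γ

namespace Compactification

variable {Γ Γ' : Subgroup PSL(2, ℝ)}

/-- For `k • ∞ = c`, the unit tangent vectors based in the open horoball `k {z | b < Im z}`
at `c`; the vector `g ∈ PSL(2, ℝ)` is based at the point `g • I`. -/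
def horoball (k : PSL(2, ℝ)) (b : ℝ) : Set PSL(2, ℝ) :=
  {g | ∃ A : SL(2, ℝ), g = k * (A : PSL(2, ℝ)) ∧ b < (A • UpperHalfPlane.I).im}

/-- `T¹S` is open and carries its own topology, and the neighbourhoods of a cusp are the sets
that contain the image of the unit tangent bundle of a horoball at the cusp. -/
instance : TopologicalSpace (Compactification Γ) where
  IsOpen U := IsOpen (point ⁻¹' U) ∧
    ∀ (k : PSL(2, ℝ)) (hk : IsParabolicPoint Γ (k • infty)), cusp (Cusp.mk (k • infty) hk) ∈ U →
      ∃ b : ℝ, ∀ g ∈ horoball k b, point (UnitTangent.mk Γ g) ∈ U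
  isOpen_univ := ⟨by simp, fun _ _ _ => ⟨0, fun _ _ => trivial⟩⟩
  isOpen_inter := by
    rintro U V ⟨hU, hU'⟩ ⟨hV, hV'⟩
    refine ⟨hU.inter hV, fun k hk hmem => ?_⟩
    obtain ⟨b, hb⟩ := hU' k hk hmem.1
    obtain ⟨b', hb'⟩ := hV' k hk hmem.2
    refine ⟨max b b', ?_⟩
    rintro g ⟨A, hg, hA⟩
    exact ⟨hb g ⟨A, hg, (le_max_left _ _).trans_lt hA⟩,
      hb' g ⟨A, hg, (le_max_right _ _).trans_lt hA⟩⟩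
  isOpen_sUnion := by
    intro 𝒰 h𝒰
    refine ⟨?_, ?_⟩
    · rw [Set.preimage_sUnion]
      exact isOpen_biUnion fun U hU => (h𝒰 U hU).1
    · rintro k hk ⟨U, hU, hmem⟩
      obtain ⟨b, hb⟩ := (h𝒰 U hU).2 k hk hmem
      exact ⟨b, fun g hg => ⟨U, hU, hb g hg⟩⟩

/-- The extension of the covering `Γ' \ PSL(2, ℝ) → Γ \ PSL(2, ℝ)` to the compactifications. -/
def cover (h : Γ' ≤ Γ) : Compactification Γ' → Compactification Γ
  | point x => point (UnitTangent.cover h x)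
  | cusp κ => cusp (Cusp.cover h κ)

end Compactification

/-- The tangent vector `x = Γ g` points to the cusp `κ`: the endpoint `g • ∞` of the geodesic ray
that it determines represents `κ`. -/
def PointsTo {Γ : Subgroup PSL(2, ℝ)} (x : UnitTangent Γ) (κ : Cusp Γ) : Prop :=
  ∃ (g : PSL(2, ℝ)) (hg : IsParabolicPoint Γ (g • infty)),
    x = UnitTangent.mk Γ g ∧ κ = Cusp.mk (g • infty) hg

/-! ### Towers of finite coverings and their inverse limits -/

/-- `Γ \ ℍ` has finite hyperbolic area: a measurable set of finite area meets every orbit. -/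
def HasFiniteArea (Γ : Subgroup PSL(2, ℝ)) : Prop :=
  ∃ D : Set UpperHalfPlane, MeasurableSet D ∧ MeasureTheory.volume D < ⊤ ∧
    ∀ z : UpperHalfPlane, ∃ A : SL(2, ℝ), (A : PSL(2, ℝ)) ∈ Γ ∧ A • z ∈ D

/-- A tower of finite coverings `⋯ → S₂ → S₁ → S₀`, with `Sₙ = Γₙ \ ℍ`, of a hyperbolic
surface `S₀` of finite area. -/
structure CoveringTower where
  Γ : ℕ → Subgroup PSL(2, ℝ)
  discrete : DiscreteTopology (Γ 0)
  torsionFree : ∀ γ ∈ Γ 0, IsOfFinOrder γ → γ = 1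
  finiteArea : HasFiniteArea (Γ 0)
  le : ∀ n, Γ (n + 1) ≤ Γ n
  finiteIndex : ∀ n, (Γ (n + 1)).relIndex (Γ n) ≠ 0

namespace CoveringTower

variable (T : CoveringTower)

/-- The inverse limit `𝒴` of the unit tangent bundles `T¹Sₙ`. -/
def Y : Type :=
  {x : ∀ n, UnitTangent (T.Γ n) // ∀ n, UnitTangent.cover (T.le n) (x (n + 1)) = x n}

instance : TopologicalSpace T.Y :=
  inferInstanceAs (TopologicalSpace
    {x : ∀ n, UnitTangent (T.Γ n) // ∀ n, UnitTangent.cover (T.le n) (x (n + 1)) = x n})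

/-- The inverse limit `𝒴̂` of the compactifications of the `T¹Sₙ`. -/
def YHat : Type :=
  {ξ : ∀ n, Compactification (T.Γ n) // ∀ n, Compactification.cover (T.le n) (ξ (n + 1)) = ξ n}

instance : TopologicalSpace T.YHat :=
  inferInstanceAs (TopologicalSpace {ξ : ∀ n, Compactification (T.Γ n) //
    ∀ n, Compactification.cover (T.le n) (ξ (n + 1)) = ξ n})

variable {T}

/-- The inclusion `𝒴 → 𝒴̂`. -/
def toYHat (x : T.Y) : T.YHat :=
  ⟨fun n => .point (x.1 n), fun n => congrArg Compactification.point (x.2 n)⟩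

variable (T) in
/-- `𝒴̂ - 𝒴`. -/
def cuspidalEnds : Set T.YHat := (Set.range (toYHat (T := T)))ᶜ

/-- The projection `π : 𝒴 → T¹S₀`. -/
def base (x : T.Y) : UnitTangent (T.Γ 0) := x.1 0

/-- The horocycle flow on `𝒴`. -/
def horocycle (s : ℝ) (x : T.Y) : T.Y :=
  ⟨fun n => (x.1 n).horocycle s, fun n =>
    (UnitTangent.cover_translate (T.le n) _ _).trans (congrArg (UnitTangent.horocycle _) (x.2 n))⟩

/-- The geodesic flow on `𝒴`. -/
def geodesic (t : ℝ) (x : T.Y) : T.Y :=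
  ⟨fun n => (x.1 n).geodesic t, fun n =>
    (UnitTangent.cover_translate (T.le n) _ _).trans (congrArg (UnitTangent.geodesic _) (x.2 n))⟩

/-- `M` is a minimal set for the horocycle flow: a nonempty closed invariant set which contains
no smaller nonempty closed invariant set. -/
def IsMinimalSet (M : Set T.Y) : Prop :=
  M.Nonempty ∧ IsClosed M ∧ IsInvariant horocycle M ∧
    ∀ N ⊆ M, N.Nonempty → IsClosed N → IsInvariant horocycle N → N = M

/-- `M` is a compact minimal set whose projection to `T¹S₀` is a closed horocyclic orbit of
period `ℓ`. -/
def IsMinimalOver (ℓ : ℝ) (M : Set T.Y) : Prop :=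
  IsCompact M ∧ IsMinimalSet M ∧
    ∃ x : UnitTangent (T.Γ 0), x.HasPeriod ℓ ∧ base '' M = Set.range fun s => x.horocycle s

/-- `M` is a minimal set over a closed horocycle (of any period). -/
def IsMinimalOverClosedHorocycle (M : Set T.Y) : Prop := ∃ ℓ, IsMinimalOver ℓ M

/-- The family `{g_t M | t ∈ ℝ}`. -/
def geodesicFamily (M : Set T.Y) : Set (Set T.Y) := Set.range fun t : ℝ => geodesic t '' M

variable (T) in
/-- The one-parameter families of minimal sets over closed horocycles. -/
def MinimalFamilies : Set (Set (Set T.Y)) :=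
  {F | ∃ M, IsMinimalOverClosedHorocycle M ∧ F = geodesicFamily M}

/-- `x = (x₀, x₁, …)` corresponds to `ξ = (ξ₀, ξ₁, …)`: each `xₙ` points to the cusp `ξₙ`. -/
def CorrespondsTo (x : T.Y) (ξ : T.YHat) : Prop :=
  ∀ n, ∃ κ : Cusp (T.Γ n), ξ.1 n = .cusp κ ∧ PointsTo (x.1 n) κ

end CoveringTower

/-! ### Odometers and suspensions -/

/-- An inverse system of permutations of finite sets. -/
structure FinitePermutationSystem where
  F : ℕ → Type
  finite : ∀ n, Finite (F n)
  perm : ∀ n, Equiv.Perm (F n)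
  q : ∀ n, F (n + 1) → F n
  q_surjective : ∀ n, Function.Surjective (q n)
  comm : ∀ n a, perm n (q n a) = q n (perm (n + 1) a)

namespace FinitePermutationSystem

variable (O : FinitePermutationSystem)

/-- The inverse limit of the finite sets. -/
def Z : Type := {z : ∀ n, O.F n // ∀ n, O.q n (z (n + 1)) = z n}

/-- The topology of the inverse limit of the discrete finite sets. -/
instance : TopologicalSpace O.Z :=
  TopologicalSpace.induced (fun z => z.1) (@Pi.topologicalSpace ℕ O.F fun _ => ⊥)

/-- The transformation of the inverse limit induced by the permutations. -/
def limitMap : Equiv.Perm O.Z where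
  toFun z := ⟨fun n => O.perm n (z.1 n), fun n => by rw [← O.comm, z.2 n]⟩
  invFun z := ⟨fun n => (O.perm n).symm (z.1 n), fun n => by
    rw [Equiv.eq_symm_apply, O.comm, Equiv.apply_symm_apply, z.2 n]⟩
  left_inv z := Subtype.ext (funext fun n => (O.perm n).symm_apply_apply (z.1 n))
  right_inv z := Subtype.ext (funext fun n => (O.perm n).apply_symm_apply (z.1 n))

/-- The transformation of the inverse limit is minimal: all its orbits are dense. -/
def IsMinimal : Prop := ∀ z : O.Z, Dense (Set.range fun k : ℤ => (O.limitMap ^ k) z)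

/-- The limit is an odometer in the strict sense (on a Cantor set): the cardinalities of the finite
sets are strictly increasing. -/
def IsOdometer : Prop := StrictMono fun n => Nat.card (O.F n)

/-- The relation on `Z × ℝ` generated by `(z, s + ℓ) ∼ (T z, s)`. -/
def suspensionSetoid (ℓ : ℝ) : Setoid (O.Z × ℝ) where
  r p p' := ∃ k : ℤ, p'.1 = (O.limitMap ^ k) p.1 ∧ p.2 = p'.2 + k * ℓ
  iseqv :=
    { refl := fun p => ⟨0, by simp, by simp⟩
      symm := by
        rintro p p' ⟨k, h, h'⟩
        refine ⟨-k, by rw [h, ← Equiv.Perm.mul_apply, ← zpow_add]; simp, ?_⟩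
        rw [h']; push_cast; ring
      trans := by
        rintro p p' p'' ⟨k, h, h'⟩ ⟨m, hm, hm'⟩
        refine ⟨m + k, by rw [hm, h, ← Equiv.Perm.mul_apply, ← zpow_add], ?_⟩
        rw [h', hm']; push_cast; ring }

/-- The suspension of the transformation of `Z`, with constant return time `ℓ`. -/
def Suspension (ℓ : ℝ) : Type := Quotient (O.suspensionSetoid ℓ)

instance (ℓ : ℝ) : TopologicalSpace (O.Suspension ℓ) :=
  inferInstanceAs (TopologicalSpace (Quotient (O.suspensionSetoid ℓ)))

/-- The class of `(z, s)` in the suspension. -/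
def Suspension.mk (ℓ : ℝ) (z : O.Z) (s : ℝ) : O.Suspension ℓ :=
  Quotient.mk (O.suspensionSetoid ℓ) (z, s)

/-- The horocycle flow on the invariant set `M` is the suspension flow: a homeomorphism
conjugates it to the flow `[z, s] ↦ [z, s + t]`. -/
def SuspendsTo (ℓ : ℝ) {T : CoveringTower} (M : Set T.Y) : Prop :=
  ∃ e : O.Suspension ℓ ≃ₜ M, ∀ (z : O.Z) (s t : ℝ),
    (e (Suspension.mk O ℓ z (s + t)) : T.Y) =
      CoveringTower.horocycle t (e (Suspension.mk O ℓ z s) : T.Y)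

end FinitePermutationSystem

end HorocycleSolenoid

end

noncomputable section

namespace HorocycleSolenoid

open Set Filter

/-! ### One-parameter subgroups and the stabilizer of `∞` -/

/-! Everything reduces to the stabilizer of `∞` in `PSL(2, ℝ)`, which consists of the products of a
diagonal and a unipotent element. A vector `Γ g` is periodic under the horocycle flow exactly when
some `g u_s g⁻¹` with `s > 0` lies in the discrete group `Γ`, that is, when `g • ∞` is a parabolic
point. Two vectors pointing to the same cusp differ by a geodesic and then a horocyclic translation
(`PointsTo.exists_eq_horocycle_geodesic`). Since `g_t` multiplies periods by `e^{-t}`, each cusp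
carries exactly one closed horocycle of each period.

In the tower, let `x` lie over a closed horocycle of period `ℓ`. Finite index makes each coordinate
`xₙ` periodic with period `pₙ ℓ` (`hasPeriod_coord`). The points whose coordinates lie on these
circles form `horocycleHull x`, a compact inverse limit of circles. It is minimal: any of its points
can be flowed until it agrees with any other at level `n`, hence at all lower levels. Minimal sets
that meet coincide, so the hulls are all the minimal sets over closed horocycles.

By the uniqueness of closed horocycles at a cusp, the hull of `x` is `pointsOver ℓ ξ`, where `ξ` is
the sequence of cusps of `x` (`pointsOver_eq_horocycleHull`). Thus pairs `(ℓ, ξ)` index the minimal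
sets, and `g_t` acts by `ℓ ↦ ℓ e^{-t}`. Fixing `ℓ = 1`, or forgetting `ℓ`, gives the two bijections.

Finally, an inverse limit of circles of lengths `pₙ ℓ` with `p₀ = 1` is the suspension of the
rotation by `1` on the inverse limit of the `ℤ / pₙ` (`exists_suspendsTo`). The `pₙ` form a
divisibility chain, so they are bounded or have a strictly increasing subsequence. -/

theorem coe_unipotent (s : ℝ) :
    (unipotent s : Matrix (Fin 2) (Fin 2) ℝ) = !![1, s; 0, 1] := rfl

theorem coe_diagonal (t : ℝ) :
    (diagonal t : Matrix (Fin 2) (Fin 2) ℝ) =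
      !![Real.exp (t / 2), 0; 0, Real.exp (-(t / 2))] := rfl

theorem unipotent_zero : unipotent 0 = 1 := by
  ext i j; fin_cases i <;> fin_cases j <;> simp [coe_unipotent]

theorem unipotent_add (s t : ℝ) : unipotent (s + t) = unipotent s * unipotent t := by
  ext i j; fin_cases i <;> fin_cases j <;> simp [coe_unipotent, add_comm]

theorem diagonal_zero : diagonal 0 = 1 := by
  ext i j; fin_cases i <;> fin_cases j <;> simp [coe_diagonal]

theorem diagonal_add (s t : ℝ) : diagonal (s + t) = diagonal s * diagonal t := by
  ext i j; fin_cases i <;> fin_cases j <;>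
    simp [coe_diagonal, ← Real.exp_add, add_div, add_comm]

/-- This commutation rule is the source of the factor `e^{-t}` by which the geodesic flow rescales
horocyclic periods. -/
theorem unipotent_mul_diagonal (s t : ℝ) :
    unipotent s * diagonal t = diagonal t * unipotent (s * Real.exp (-t)) := by
  have h : Real.exp (-(t / 2)) = Real.exp (t / 2) * Real.exp (-t) := by
    rw [← Real.exp_add]; congr 1; ring
  ext i j; fin_cases i <;> fin_cases j <;> simp [coe_unipotent, coe_diagonal, h]
  ring

theorem continuous_unipotent : Continuous unipotent := by
  refine Continuous.subtype_mk ?_ _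
  refine continuous_matrix fun i j => ?_
  fin_cases i <;> fin_cases j <;> simp <;> fun_prop

theorem mk_neg (A : SL(2, ℝ)) : ((-A : SL(2, ℝ)) : PSL(2, ℝ)) = (A : PSL(2, ℝ)) := by
  rw [QuotientGroup.eq, Matrix.SpecialLinearGroup.mem_center_iff]
  refine ⟨-1, by simp, ?_⟩
  have : (-A)⁻¹ * A = -1 := by
    rw [inv_mul_eq_iff_eq_mul]; simp
  rw [this]
  simp [Matrix.scalar_apply, ← Matrix.diagonal_neg]

theorem SL_smul_infty (A : SL(2, ℝ)) :
    (A : PSL(2, ℝ)) • infty = infty ↔ (A : Matrix (Fin 2) (Fin 2) ℝ) 1 0 = 0 := by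
  have h : (A : PSL(2, ℝ)) • infty = Projectivization.mk ℝ
      ((A : Matrix (Fin 2) (Fin 2) ℝ).mulVec ![1, 0])
      (fun h => by
        have := congrArg ((A⁻¹ : SL(2, ℝ)) : Matrix (Fin 2) (Fin 2) ℝ).mulVec h
        rw [Matrix.mulVec_mulVec, ← Matrix.SpecialLinearGroup.coe_mul] at this
        simpa using congrFun this 0) := rfl
  rw [h, infty, Projectivization.mk_eq_mk_iff']
  constructor
  · rintro ⟨a, ha⟩
    simpa [Matrix.mulVec, dotProduct] using (congrFun ha 1).symm
  · intro h
    refine ⟨(A : Matrix (Fin 2) (Fin 2) ℝ) 0 0, ?_⟩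
    ext i; fin_cases i <;> simp [Matrix.mulVec, dotProduct, h]

theorem unipotent_smul_infty (s : ℝ) : (unipotent s : PSL(2, ℝ)) • infty = infty := by
  rw [SL_smul_infty]; simp [coe_unipotent]

theorem diagonal_smul_infty (t : ℝ) : (diagonal t : PSL(2, ℝ)) • infty = infty := by
  rw [SL_smul_infty]; simp [coe_diagonal]

theorem exists_eq_diagonal_mul_unipotent (A : SL(2, ℝ))
    (h : (A : Matrix (Fin 2) (Fin 2) ℝ) 1 0 = 0) :
    ∃ t s, A = diagonal t * unipotent s ∨ A = -(diagonal t * unipotent s) := by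
  have hd := A.det_coe
  rw [Matrix.det_fin_two, h, mul_zero, sub_zero] at hd
  set a := (A : Matrix (Fin 2) (Fin 2) ℝ) 0 0 with ha
  set b := (A : Matrix (Fin 2) (Fin 2) ℝ) 0 1 with hb
  set d := (A : Matrix (Fin 2) (Fin 2) ℝ) 1 1 with hd'
  have ha0 : a ≠ 0 := left_ne_zero_of_mul_eq_one hd
  have hda : d = a⁻¹ := eq_inv_of_mul_eq_one_right hd
  have he : Real.exp (Real.log |a|) = |a| := Real.exp_log (abs_pos.2 ha0)
  -- The time is chosen so that `e^{t/2} = |a|`; the sign of `a` selects the alternative, and both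
  -- become equal in `PSL(2, ℝ)`.
  refine ⟨2 * Real.log |a|, b / a, ?_⟩
  rcases lt_or_gt_of_ne ha0 with hneg | hpos
  · right
    rw [abs_of_neg hneg] at he ⊢
    ext i j; fin_cases i <;> fin_cases j <;>
      simp [coe_unipotent, coe_diagonal, h, Real.exp_neg, -Real.log_neg_eq_log, he, ← ha, ← hb, ← hd', hda, inv_neg]
    field_simp
  · left
    rw [abs_of_pos hpos] at he ⊢
    ext i j; fin_cases i <;> fin_cases j <;>
      simp [coe_unipotent, coe_diagonal, h, Real.exp_neg, he, ← ha, ← hb, ← hd', hda]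
    field_simp

theorem exists_of_smul_infty_eq {g : PSL(2, ℝ)} (h : g • infty = infty) :
    ∃ t s, g = (diagonal t : PSL(2, ℝ)) * (unipotent s : PSL(2, ℝ)) := by
  induction g using QuotientGroup.induction_on with
  | _ A =>
    obtain ⟨t, s, h | h⟩ := exists_eq_diagonal_mul_unipotent A ((SL_smul_infty A).1 h)
    · exact ⟨t, s, by rw [h]; rfl⟩
    · exact ⟨t, s, by rw [h, mk_neg]; rfl⟩

theorem exists_of_smul_infty_eq_smul_infty {g k : PSL(2, ℝ)} (h : g • infty = k • infty) :
    ∃ t s, g = k * ((diagonal t : PSL(2, ℝ)) * (unipotent s : PSL(2, ℝ))) := by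
  obtain ⟨t, s, hts⟩ := exists_of_smul_infty_eq (g := k⁻¹ * g) (by rw [mul_smul, h, inv_smul_smul])
  exact ⟨t, s, by rw [← hts, mul_inv_cancel_left]⟩

theorem isParabolic_conj_iff (U A : SL(2, ℝ)) :
    ((U * A * U⁻¹ : SL(2, ℝ)) : Matrix (Fin 2) (Fin 2) ℝ).IsParabolic ↔
      (A : Matrix (Fin 2) (Fin 2) ℝ).IsParabolic := by
  have := Matrix.isParabolic_conj_iff (g := (U : GL (Fin 2) ℝ)) (m := (A : Matrix (Fin 2) (Fin 2) ℝ))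
  rw [← this]
  simp [Matrix.inv_def]

theorem unipotent_eq_one {s : ℝ} (h : (unipotent s : PSL(2, ℝ)) = 1) : s = 0 := by
  rw [QuotientGroup.eq_one_iff, Matrix.SpecialLinearGroup.mem_center_iff] at h
  obtain ⟨r, -, hr⟩ := h
  have := congrFun (congrFun hr 0) 1
  simpa [unipotent] using this.symm

/-- Conjugating by `g` moves the fixed point to `∞`, where a parabolic matrix of determinant `1` is
a unipotent one up to sign. Passing to the inverse makes the parameter positive. -/
theorem isParabolicPoint_smul_infty_iff {Γ : Subgroup PSL(2, ℝ)} {g : PSL(2, ℝ)} :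
    IsParabolicPoint Γ (g • infty) ↔
      ∃ s, 0 < s ∧ g * (unipotent s : PSL(2, ℝ)) * g⁻¹ ∈ Γ := by
  induction g using QuotientGroup.induction_on with
  | _ U =>
  constructor
  · rintro ⟨A, hA, hp, hfix⟩
    obtain ⟨B, rfl⟩ : ∃ B, A = U * B * U⁻¹ := ⟨U⁻¹ * A * U, by group⟩
    rw [isParabolic_conj_iff] at hp
    have hB : (B : PSL(2, ℝ)) • infty = infty := by
      have h : ((U : PSL(2, ℝ)) * B * (U : PSL(2, ℝ))⁻¹) • (U : PSL(2, ℝ)) • infty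
        = (U : PSL(2, ℝ)) • infty := hfix
      rwa [smul_smul, inv_mul_cancel_right, mul_smul, smul_left_cancel_iff] at h
    have hs : ∃ s, s ≠ 0 ∧ (B : PSL(2, ℝ)) = (unipotent s : PSL(2, ℝ)) := by
      rw [SL_smul_infty] at hB
      rw [Matrix.isParabolic_iff_of_upperTriangular hB] at hp
      have hd := B.det_coe
      rw [Matrix.det_fin_two, hB, mul_zero, sub_zero, ← hp.1] at hd
      rcases mul_self_eq_one_iff.1 hd with h | h
      · refine ⟨_, hp.2, congrArg _ ?_⟩
        ext i j; fin_cases i <;> fin_cases j <;> simp [coe_unipotent, h, hB, ← hp.1]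
      · refine ⟨_, neg_ne_zero.2 hp.2, ?_⟩
        rw [← mk_neg]
        congr 1
        ext i j; fin_cases i <;> fin_cases j <;> simp [coe_unipotent, h, hB, ← hp.1]
    obtain ⟨s, hs0, hs⟩ := hs
    have hA' : (U : PSL(2, ℝ)) * (unipotent s : PSL(2, ℝ)) * (U : PSL(2, ℝ))⁻¹ ∈ Γ := by
      rw [← hs]; exact hA
    rcases lt_or_gt_of_ne hs0 with h | h
    · refine ⟨-s, neg_pos.2 h, ?_⟩
      have : (unipotent (-s) : PSL(2, ℝ)) = (unipotent s : PSL(2, ℝ))⁻¹ := by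
        rw [eq_inv_iff_mul_eq_one, ← QuotientGroup.mk_mul, ← unipotent_add]
        simp [unipotent_zero]
      rw [this]
      simpa [mul_assoc] using Γ.inv_mem hA'
    · exact ⟨s, h, hA'⟩
  · rintro ⟨s, hs, h⟩
    refine ⟨U * unipotent s * U⁻¹, h, ?_, ?_⟩
    · rw [isParabolic_conj_iff, Matrix.isParabolic_iff_of_upperTriangular (by simp [coe_unipotent])]
      simp [coe_unipotent, hs.ne']
    · change ((U : PSL(2, ℝ)) * (unipotent s : PSL(2, ℝ)) * (U : PSL(2, ℝ))⁻¹) • _ = _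
      rw [smul_smul, inv_mul_cancel_right, mul_smul, unipotent_smul_infty]

/-! ### The topology of `PSL(2, ℝ)` -/

theorem continuous_mk_unipotent : Continuous fun s => (unipotent s : PSL(2, ℝ)) :=
  QuotientGroup.continuous_mk.comp continuous_unipotent

instance t2Space_PSL : T2Space PSL(2, ℝ) := by
  have : IsClosed ((Subgroup.center SL(2, ℝ) : Subgroup SL(2, ℝ)) : Set SL(2, ℝ)) := by
    have : ((Subgroup.center SL(2, ℝ) : Subgroup SL(2, ℝ)) : Set SL(2, ℝ))
        = ⋂ A : SL(2, ℝ), {B | A * B = B * A} := by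
      ext B; simp [Subgroup.mem_center_iff]
    rw [this]
    exact isClosed_iInter fun A => isClosed_eq (by fun_prop) (by fun_prop)
  have : T3Space PSL(2, ℝ) := by
    unfold Matrix.ProjectiveSpecialLinearGroup; infer_instance
  infer_instance

/-! ### The unit tangent bundle -/

namespace UnitTangent

variable {Γ Γ' : Subgroup PSL(2, ℝ)}

theorem mk_eq_mk {g g' : PSL(2, ℝ)} : mk Γ g = mk Γ g' ↔ g' * g⁻¹ ∈ Γ := by
  rw [← QuotientGroup.rightRel_apply]
  exact Quotient.eq

theorem mk_mul_left {γ : PSL(2, ℝ)} (hγ : γ ∈ Γ) (g : PSL(2, ℝ)) : mk Γ (γ * g) = mk Γ g := by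
  rw [mk_eq_mk]
  simpa using hγ

theorem mk_surjective : Function.Surjective (mk Γ) := Quotient.mk_surjective

theorem continuous_mk : Continuous (mk Γ) := continuous_quotient_mk'

theorem isOpenQuotientMap_mk : IsOpenQuotientMap (mk Γ) := by
  refine ⟨mk_surjective, continuous_mk, fun U hU => ?_⟩
  change IsOpen (mk Γ ⁻¹' (mk Γ '' U))
  have : mk Γ ⁻¹' (mk Γ '' U) = ⋃ γ : Γ, (fun g => (γ : PSL(2, ℝ)) * g) ⁻¹' U := by
    ext g
    simp only [mem_preimage, mem_image, mem_iUnion]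
    constructor
    · rintro ⟨u, hu, h⟩
      exact ⟨⟨u * g⁻¹, mk_eq_mk.1 h.symm⟩, by simpa using hu⟩
    · rintro ⟨γ, h⟩
      exact ⟨_, h, mk_mul_left γ.2 g⟩
  rw [this]
  exact isOpen_iUnion fun γ => hU.preimage (continuous_const_mul _)

theorem t2Space (h : IsClosed (Γ : Set PSL(2, ℝ))) : T2Space (UnitTangent Γ) := by
  rw [t2Space_iff_of_isOpenQuotientMap isOpenQuotientMap_mk]
  have : {q : PSL(2, ℝ) × PSL(2, ℝ) | mk Γ q.1 = mk Γ q.2} =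
      (fun q : PSL(2, ℝ) × PSL(2, ℝ) => q.2 * q.1⁻¹) ⁻¹' Γ := by
    ext q; exact mk_eq_mk
  rw [this]
  exact h.preimage (by fun_prop)

@[simp] theorem horocycle_mk (s : ℝ) (g : PSL(2, ℝ)) :
    horocycle s (mk Γ g) = mk Γ (g * (unipotent s : PSL(2, ℝ))) := rfl
@[simp] theorem geodesic_mk (t : ℝ) (g : PSL(2, ℝ)) :
    geodesic t (mk Γ g) = mk Γ (g * (diagonal t : PSL(2, ℝ))) := rfl
@[simp] theorem cover_mk (h : Γ' ≤ Γ) (g : PSL(2, ℝ)) : cover h (mk Γ' g) = mk Γ g := rfl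

theorem continuous_cover (h : Γ' ≤ Γ) : Continuous (cover h) := by
  rw [isOpenQuotientMap_mk.isQuotientMap.continuous_iff]
  exact continuous_mk

theorem horocycle_zero (x : UnitTangent Γ) : horocycle 0 x = x := by
  obtain ⟨g, rfl⟩ := mk_surjective x
  rw [horocycle_mk, unipotent_zero]
  simp

theorem horocycle_add (s t : ℝ) (x : UnitTangent Γ) :
    horocycle (s + t) x = horocycle s (horocycle t x) := by
  obtain ⟨g, rfl⟩ := mk_surjective x
  rw [add_comm, horocycle_mk, unipotent_add, QuotientGroup.mk_mul, ← mul_assoc]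
  rfl

theorem continuous_horocycle (x : UnitTangent Γ) : Continuous fun s => horocycle s x := by
  obtain ⟨g, rfl⟩ := mk_surjective x
  exact continuous_mk.comp (continuous_const.mul continuous_mk_unipotent)

theorem geodesic_zero (x : UnitTangent Γ) : geodesic 0 x = x := by
  obtain ⟨g, rfl⟩ := mk_surjective x
  rw [geodesic_mk, diagonal_zero]
  simp

theorem geodesic_add (s t : ℝ) (x : UnitTangent Γ) :
    geodesic (s + t) x = geodesic s (geodesic t x) := by
  obtain ⟨g, rfl⟩ := mk_surjective x
  rw [add_comm, geodesic_mk, diagonal_add, QuotientGroup.mk_mul, ← mul_assoc]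
  rfl

theorem geodesic_horocycle (s t : ℝ) (x : UnitTangent Γ) :
    geodesic t (horocycle s x) = horocycle (s * Real.exp (-t)) (geodesic t x) := by
  obtain ⟨g, rfl⟩ := mk_surjective x
  simp only [horocycle_mk, geodesic_mk, mul_assoc]
  rw [← QuotientGroup.mk_mul, ← QuotientGroup.mk_mul, unipotent_mul_diagonal]

theorem geodesic_injective (t : ℝ) : Function.Injective (geodesic (Γ := Γ) t) := fun x y h => by
  have := congrArg (geodesic (-t)) h
  simpa [← geodesic_add, geodesic_zero] using this

theorem horocycle_injective (t : ℝ) : Function.Injective (horocycle (Γ := Γ) t) := fun x y h => by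
  have := congrArg (horocycle (-t)) h
  simpa [← horocycle_add, horocycle_zero] using this

theorem horocycle_eq_iff (s t : ℝ) (x : UnitTangent Γ) :
    horocycle s x = horocycle t x ↔ horocycle (s - t) x = x := by
  rw [← (horocycle_injective t).eq_iff (a := horocycle (s - t) x), ← horocycle_add, add_sub_cancel]

theorem HasPeriod.horocycle {x : UnitTangent Γ} {ℓ : ℝ} (h : x.HasPeriod ℓ) (s : ℝ) :
    (x.horocycle s).HasPeriod ℓ := by
  have key (t : ℝ) : (x.horocycle s).horocycle t = x.horocycle s ↔ x.horocycle t = x := by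
    rw [← horocycle_add, add_comm, horocycle_add, (horocycle_injective s).eq_iff]
  refine ⟨h.1, (key _).2 h.2.1, fun t ht ht' => ?_⟩
  rw [Ne, key]
  exact h.2.2 t ht ht'

theorem HasPeriod.geodesic {x : UnitTangent Γ} {ℓ : ℝ} (h : x.HasPeriod ℓ) (t : ℝ) :
    (x.geodesic t).HasPeriod (ℓ * Real.exp (-t)) := by
  have he := Real.exp_pos (-t)
  refine ⟨mul_pos h.1 he, by rw [← geodesic_horocycle, h.2.1], fun s hs hs' hx => ?_⟩
  refine h.2.2 (s / Real.exp (-t)) (by positivity) ((div_lt_iff₀ he).2 hs') ?_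
  apply geodesic_injective t
  rwa [geodesic_horocycle, div_mul_cancel₀ _ he.ne']

theorem HasPeriod.unique {x : UnitTangent Γ} {ℓ ℓ' : ℝ} (h : x.HasPeriod ℓ)
    (h' : x.HasPeriod ℓ') : ℓ = ℓ' := by
  rcases lt_trichotomy ℓ ℓ' with hl | hl | hl
  · exact absurd h.2.1 (h'.2.2 ℓ h.1 hl)
  · exact hl
  · exact absurd h'.2.1 (h.2.2 ℓ' h'.1 hl)

/-- The set of the times at which the horocycle flow returns to `x`. -/
def returnTimes (x : UnitTangent Γ) : AddSubgroup ℝ where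
  carrier := {s | horocycle s x = x}
  zero_mem' := horocycle_zero x
  add_mem' {s t} hs ht := by
    change horocycle _ x = x at *
    rw [horocycle_add, ht, hs]
  neg_mem' {s} hs := by
    change horocycle _ x = x at *
    apply horocycle_injective s
    rw [← horocycle_add, hs, add_neg_cancel, horocycle_zero]

theorem mem_returnTimes {x : UnitTangent Γ} {s : ℝ} :
    s ∈ returnTimes x ↔ horocycle s x = x := Iff.rfl

theorem HasPeriod.returnTimes_eq {x : UnitTangent Γ} {ℓ : ℝ} (h : x.HasPeriod ℓ) :
    returnTimes x = AddSubgroup.zmultiples ℓ := by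
  rw [AddSubgroup.zmultiples_eq_closure]
  refine AddSubgroup.cyclic_of_min ⟨⟨h.2.1, h.1⟩, fun s hs => ?_⟩
  by_contra! hlt
  exact h.2.2 s hs.2 hlt hs.1

theorem HasPeriod.horocycle_eq_self_iff {x : UnitTangent Γ} {ℓ : ℝ} (h : x.HasPeriod ℓ) {s : ℝ} :
    UnitTangent.horocycle s x = x ↔ ∃ k : ℤ, s = k * ℓ := by
  rw [← mem_returnTimes, h.returnTimes_eq, AddSubgroup.mem_zmultiples_iff]
  simp [eq_comm]

theorem mk_mem_returnTimes {g : PSL(2, ℝ)} {s : ℝ} :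
    horocycle s (mk Γ g) = mk Γ g ↔ g * (unipotent s : PSL(2, ℝ)) * g⁻¹ ∈ Γ := by
  rw [eq_comm, horocycle_mk, mk_eq_mk]

/-- Discreteness keeps return times away from `0`, and a nontrivial subgroup of `ℝ` with such a gap
has a least positive element. -/
theorem exists_hasPeriod (hΓ : DiscreteTopology Γ) {x : UnitTangent Γ} {s : ℝ} (hs : 0 < s)
    (h : horocycle s x = x) : ∃ ℓ, x.HasPeriod ℓ := by
  obtain ⟨g, rfl⟩ := mk_surjective x
  obtain ⟨U, hU, hUΓ⟩ : ∃ U ∈ 𝓝 (1 : PSL(2, ℝ)), ∀ γ ∈ U, γ ∈ Γ → γ = 1 := by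
    have h1 : {(1 : Γ)} ∈ 𝓝 (1 : Γ) := by simp [nhds_discrete]
    rw [nhds_subtype_eq_comap] at h1
    obtain ⟨U, hU, hs⟩ := h1
    exact ⟨U, hU, fun γ hγ hγ' => by simpa using @hs ⟨γ, hγ'⟩ hγ⟩
  have hc : Continuous fun s => g * (unipotent s : PSL(2, ℝ)) * g⁻¹ :=
    (continuous_const.mul continuous_mk_unipotent).mul continuous_const
  have h0 : ∀ᶠ s in 𝓝 (0 : ℝ), g * (unipotent s : PSL(2, ℝ)) * g⁻¹ ∈ U := by
    refine hc.continuousAt.eventually_mem ?_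
    rw [unipotent_zero]
    simpa using hU
  obtain ⟨a, ha, hball⟩ := Metric.eventually_nhds_iff.1 h0
  have hdisj : Disjoint (returnTimes (mk Γ g) : Set ℝ) (Ioo 0 a) := by
    rw [Set.disjoint_left]
    rintro r hr ⟨hr0, hra⟩
    have := hUΓ _ (hball (by simpa [abs_of_pos hr0] using hra)) (mk_mem_returnTimes.1 hr)
    rw [mul_inv_eq_one, mul_eq_left] at this
    exact hr0.ne' (unipotent_eq_one this)
  have hne : returnTimes (mk Γ g) ≠ ⊥ := fun hbot => by
    have : s ∈ returnTimes (mk Γ g) := h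
    rw [hbot, AddSubgroup.mem_bot] at this
    exact hs.ne' this
  obtain ⟨ℓ, hℓ⟩ := AddSubgroup.exists_isLeast_pos hne ha hdisj
  exact ⟨ℓ, hℓ.1.2, hℓ.1.1, fun t ht htℓ htx => htℓ.not_ge (hℓ.2 ⟨htx, ht⟩)⟩

end UnitTangent

/-! ### Tangent vectors pointing to cusps -/

namespace Cusp

variable {Γ Γ' : Subgroup PSL(2, ℝ)}

theorem mk_eq_mk {c c' : Boundary} {hc : IsParabolicPoint Γ c} {hc' : IsParabolicPoint Γ c'} :
    mk c hc = mk c' hc' ↔ ∃ γ ∈ Γ, γ • c = c' := Quotient.eq (r := cuspSetoid Γ)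

theorem exists_rep (κ : Cusp Γ) :
    ∃ (g : PSL(2, ℝ)) (hg : IsParabolicPoint Γ (g • infty)), κ = mk (g • infty) hg := by
  induction κ using Quotient.inductionOn with
  | _ c =>
    obtain ⟨c, hc⟩ := c
    obtain ⟨g, rfl⟩ := MulAction.exists_smul_eq PSL(2, ℝ) infty c
    exact ⟨g, hc, rfl⟩

end Cusp

namespace PointsTo

open UnitTangent

variable {Γ Γ' : Subgroup PSL(2, ℝ)} {x y : UnitTangent Γ} {κ κ' : Cusp Γ}

/-- The cusp does not depend on the representative: another one differs by an element of `Γ`, which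
conjugates parabolics and moves endpoints within an orbit. -/
theorem mk_iff {g : PSL(2, ℝ)} : PointsTo (mk Γ g) κ ↔
    ∃ hg : IsParabolicPoint Γ (g • infty), κ = Cusp.mk (g • infty) hg := by
  refine ⟨?_, fun ⟨hg, h⟩ => ⟨g, hg, rfl, h⟩⟩
  rintro ⟨k, hk, hgk, rfl⟩
  have hγ := mk_eq_mk.1 hgk
  have hg : IsParabolicPoint Γ (g • infty) := by
    rw [isParabolicPoint_smul_infty_iff] at hk ⊢
    obtain ⟨s, hs, h⟩ := hk
    refine ⟨s, hs, ?_⟩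
    have := Γ.mul_mem (Γ.mul_mem (Γ.inv_mem hγ) h) hγ
    convert this using 1
    group
  refine ⟨hg, Cusp.mk_eq_mk.2 ⟨g * k⁻¹, ?_, ?_⟩⟩
  · simpa using Γ.inv_mem hγ
  · rw [smul_smul, inv_mul_cancel_right]

theorem exists_pointsTo (κ : Cusp Γ) : ∃ x, PointsTo x κ := by
  obtain ⟨g, hg, rfl⟩ := κ.exists_rep
  exact ⟨_, g, hg, rfl, rfl⟩

theorem translate (h : PointsTo x κ) {a : PSL(2, ℝ)} (ha : a • infty = infty) :
    PointsTo (x.translate a) κ := by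
  obtain ⟨g, hg, rfl, rfl⟩ := h
  have : g • infty = (g * a) • infty := by rw [mul_smul, ha]
  exact ⟨g * a, this ▸ hg, rfl, by simp only [← this]⟩

theorem horocycle (h : PointsTo x κ) (s : ℝ) : PointsTo (x.horocycle s) κ :=
  h.translate (unipotent_smul_infty s)

theorem geodesic (h : PointsTo x κ) (t : ℝ) : PointsTo (x.geodesic t) κ :=
  h.translate (diagonal_smul_infty t)

theorem unique (h : PointsTo x κ) (h' : PointsTo x κ') : κ = κ' := by
  obtain ⟨g, hg, rfl, rfl⟩ := h
  obtain ⟨_, rfl⟩ := mk_iff.1 h'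
  rfl

theorem cover (hle : Γ' ≤ Γ) {x : UnitTangent Γ'} {κ : Cusp Γ'} (h : PointsTo x κ) :
    PointsTo (UnitTangent.cover hle x) (Cusp.cover hle κ) := by
  obtain ⟨g, hg, rfl, rfl⟩ := h
  exact ⟨g, _, rfl, rfl⟩

/-- Among the representatives of `x`, one ends exactly at a chosen representative of `κ'`; its
`Γ'`-coset is the lift. -/
theorem exists_lift (hle : Γ' ≤ Γ) {κ' : Cusp Γ'} (h : PointsTo x (Cusp.cover hle κ')) :
    ∃ x', UnitTangent.cover hle x' = x ∧ PointsTo x' κ' := by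
  obtain ⟨k, hk, rfl⟩ := κ'.exists_rep
  obtain ⟨g, hg, rfl, hκ⟩ := h
  obtain ⟨γ, hγ, h⟩ := Cusp.mk_eq_mk.1 hκ
  have h' : (γ⁻¹ * g) • infty = k • infty := by rw [mul_smul, ← h, inv_smul_smul]
  refine ⟨mk Γ' (γ⁻¹ * g), mk_mul_left (Γ.inv_mem hγ) g, γ⁻¹ * g, h' ▸ hk, rfl, ?_⟩
  simp only [h']

theorem exists_eq_horocycle_geodesic (hx : PointsTo x κ) (hy : PointsTo y κ) :
    ∃ t s, y = (x.geodesic t).horocycle s := by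
  obtain ⟨g, hg, rfl, rfl⟩ := hx
  obtain ⟨k, hk, rfl, h⟩ := hy
  obtain ⟨γ, hγ, h⟩ := Cusp.mk_eq_mk.1 h
  rw [smul_smul, eq_comm] at h
  obtain ⟨t, s, rfl⟩ := exists_of_smul_infty_eq_smul_infty h
  refine ⟨t, s, ?_⟩
  rw [mul_assoc, mk_mul_left hγ, ← mul_assoc]
  rfl

theorem exists_hasPeriod (hΓ : DiscreteTopology Γ) (h : PointsTo x κ) : ∃ ℓ, x.HasPeriod ℓ := by
  obtain ⟨g, hg, rfl, rfl⟩ := h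
  obtain ⟨s, hs, h⟩ := isParabolicPoint_smul_infty_iff.1 hg
  exact UnitTangent.exists_hasPeriod hΓ hs (mk_mem_returnTimes.2 h)

theorem exists_of_hasPeriod {ℓ : ℝ} (h : x.HasPeriod ℓ) : ∃ κ, PointsTo x κ := by
  obtain ⟨g, rfl⟩ := mk_surjective x
  exact ⟨_, g, isParabolicPoint_smul_infty_iff.2 ⟨ℓ, h.1, mk_mem_returnTimes.1 h.2.1⟩, rfl, rfl⟩

theorem im_diagonal_smul_I (t : ℝ) : (diagonal t • UpperHalfPlane.I).im = Real.exp t := by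
  have h : Real.exp t = Real.exp (t / 2) * Real.exp (t / 2) := by
    rw [← Real.exp_add, add_halves]
  rw [← UpperHalfPlane.coe_im, UpperHalfPlane.coe_specialLinearGroup_apply, h]
  simp [coe_diagonal, Real.exp_neg, -Complex.ofReal_exp]

theorem tendsto_geodesic (h : PointsTo x κ) :
    Tendsto (fun t => Compactification.point (x.geodesic t)) atTop (𝓝 (.cusp κ)) := by
  obtain ⟨g, hg, rfl, rfl⟩ := h
  rw [tendsto_nhds]
  rintro U ⟨-, hU⟩ hmem
  obtain ⟨b, hb⟩ := hU g hg hmem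
  filter_upwards [Real.tendsto_exp_atTop.eventually_gt_atTop b] with t ht
  -- In the coordinates given by `g`, the vector at time `t` is based at height `e^t`.
  refine hb _ ⟨diagonal t, rfl, ?_⟩
  rwa [im_diagonal_smul_I]

end PointsTo

/-! ### The inverse limit -/

namespace CoveringTower

open UnitTangent

variable {T : CoveringTower}

theorem antitone_Γ (T : CoveringTower) : Antitone T.Γ := antitone_nat_of_succ_le T.le

theorem relIndex_zero_ne_zero (T : CoveringTower) (n : ℕ) : (T.Γ n).relIndex (T.Γ 0) ≠ 0 := by
  induction n with
  | zero => simp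
  | succ n ih => exact Subgroup.relIndex_ne_zero_trans (T.finiteIndex n) ih

theorem discreteTopology_Γ (T : CoveringTower) (n : ℕ) : DiscreteTopology (T.Γ n) :=
  have := T.discrete
  DiscreteTopology.of_subset (s := (T.Γ 0 : Set PSL(2, ℝ))) this (T.antitone_Γ n.zero_le)

instance t2Space_unitTangent (n : ℕ) : T2Space (UnitTangent (T.Γ n)) :=
  have := T.discreteTopology_Γ n
  UnitTangent.t2Space (Subgroup.isClosed_of_discrete (H := T.Γ n))

theorem isClosedEmbedding_val : Topology.IsClosedEmbedding fun x : T.Y => x.1 := by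
  refine IsClosed.isClosedEmbedding_subtypeVal ?_
  have : {x : ∀ n, UnitTangent (T.Γ n) | ∀ n, cover (T.le n) (x (n + 1)) = x n} =
      ⋂ n, {x | cover (T.le n) (x (n + 1)) = x n} := by ext; simp
  change IsClosed {x : ∀ n, UnitTangent (T.Γ n) | ∀ n, cover (T.le n) (x (n + 1)) = x n}
  rw [this]
  exact isClosed_iInter fun n =>
    isClosed_eq ((continuous_cover _).comp (continuous_apply _)) (continuous_apply _)

instance t2Space_Y : T2Space T.Y := isClosedEmbedding_val.isEmbedding.t2Space

theorem cover_coord (x : T.Y) {m n : ℕ} (h : m ≤ n) :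
    cover (T.antitone_Γ h) (x.1 n) = x.1 m := by
  induction n, h using Nat.le_induction with
  | base =>
    obtain ⟨g, hg⟩ := mk_surjective (x.1 m)
    rw [← hg, cover_mk]
  | succ n hmn ih =>
    rw [← ih, ← x.2 n]
    obtain ⟨g, hg⟩ := mk_surjective (x.1 (n + 1))
    rw [← hg]
    rfl

@[simp] theorem horocycle_coord (s : ℝ) (x : T.Y) (n : ℕ) :
    (horocycle s x).1 n = (x.1 n).horocycle s := rfl

@[simp] theorem geodesic_coord (s : ℝ) (x : T.Y) (n : ℕ) :
    (geodesic s x).1 n = (x.1 n).geodesic s := rfl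

theorem Y_ext {x y : T.Y} (h : ∀ n, x.1 n = y.1 n) : x = y := Subtype.ext (funext h)

theorem coord_eq_horocycle_of_le {x y : T.Y} {m n : ℕ} (h : m ≤ n) {s : ℝ}
    (hs : y.1 n = (x.1 n).horocycle s) : y.1 m = (x.1 m).horocycle s := by
  rw [← cover_coord y h, hs, ← cover_coord x h]
  exact cover_translate _ _ _

theorem geodesic_zero (x : T.Y) : geodesic 0 x = x :=
  Y_ext fun _ => UnitTangent.geodesic_zero _

theorem geodesic_add (s t : ℝ) (x : T.Y) :
    geodesic (s + t) x = geodesic s (geodesic t x) :=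
  Y_ext fun _ => UnitTangent.geodesic_add s t _

/-- Finite index suffices, without normality: a positive power of the parabolic element closing up
the base horocycle lies in `Γₙ`. -/
theorem hasPeriod_coord {x : T.Y} {ℓ : ℝ} (h : (base x).HasPeriod ℓ) (n : ℕ) :
    ∃ p : ℕ, 0 < p ∧ (x.1 n).HasPeriod (p * ℓ) := by
  obtain ⟨g, hg⟩ := mk_surjective (x.1 n)
  have h0 : x.1 0 = UnitTangent.mk (T.Γ 0) g := by
    rw [← cover_coord x n.zero_le, ← hg, cover_mk]
  have hret := h.2.1
  rw [base, h0, mk_mem_returnTimes] at hret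
  obtain ⟨k, hk, -, hmem⟩ := Subgroup.exists_pow_mem_of_relIndex_ne_zero
    (T.relIndex_zero_ne_zero n) hret
  have hpow : ∀ k : ℕ, (g * (unipotent ℓ : PSL(2, ℝ)) * g⁻¹) ^ k =
      g * (unipotent (k * ℓ) : PSL(2, ℝ)) * g⁻¹ := by
    intro k
    induction k with
    | zero => simp [unipotent_zero]
    | succ k ih =>
      rw [pow_succ, ih, Nat.cast_succ, add_mul, one_mul, unipotent_add, QuotientGroup.mk_mul]
      group
  rw [hpow] at hmem
  obtain ⟨r, hr⟩ := UnitTangent.exists_hasPeriod (T.discreteTopology_Γ n)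
    (mul_pos (Nat.cast_pos.2 hk) h.1) (mk_mem_returnTimes.2 hmem.1)
  rw [hg] at hr
  -- A return time at level `n` is one at level `0`, hence an integer multiple of `ℓ`.
  obtain ⟨p, rfl⟩ := h.horocycle_eq_self_iff.1
    (coord_eq_horocycle_of_le (x := x) (y := x) n.zero_le hr.2.1.symm).symm
  have hp : 0 < p := by
    have := pos_of_mul_pos_left hr.1 h.1.le
    exact_mod_cast this
  lift p to ℕ using hp.le
  exact ⟨p, by exact_mod_cast hp, by exact_mod_cast hr⟩

/-! ### Minimal sets over closed horocycles -/

/-- The points of `𝒴` whose coordinates lie on the horocycles of the coordinates of `x`. -/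
def horocycleHull (x : T.Y) : Set T.Y := {y | ∀ n, ∃ s, y.1 n = (x.1 n).horocycle s}

theorem mem_horocycleHull_self (x : T.Y) : x ∈ horocycleHull x :=
  fun _ => ⟨0, (UnitTangent.horocycle_zero _).symm⟩

theorem horocycle_mem_horocycleHull {x y : T.Y} (h : y ∈ horocycleHull x) (s : ℝ) :
    horocycle s y ∈ horocycleHull x := fun n => by
  obtain ⟨t, ht⟩ := h n
  exact ⟨s + t, by rw [horocycle_coord, ht, UnitTangent.horocycle_add]⟩

theorem isCompact_range_horocycle {Γ : Subgroup PSL(2, ℝ)} {x : UnitTangent Γ} {ℓ : ℝ}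
    (h : x.HasPeriod ℓ) : IsCompact (range fun s => x.horocycle s) := by
  have hp : Function.Periodic (fun s => x.horocycle s) ℓ := fun s => by
    simp only [UnitTangent.horocycle_add, h.2.1]
  exact hp.compact_of_continuous h.1.ne' (UnitTangent.continuous_horocycle x)

/-- The hull is the part of a product of circles, one for each level, that lies in the closed
subspace `𝒴`. -/
theorem isCompact_horocycleHull {x : T.Y} {ℓ : ℝ} (h : (base x).HasPeriod ℓ) :
    IsCompact (horocycleHull x) := by
  have hK : IsCompact (Set.univ.pi fun n => range fun s => (x.1 n).horocycle s) :=
    isCompact_univ_pi fun n => isCompact_range_horocycle (hasPeriod_coord h n).choose_spec.2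
  convert isClosedEmbedding_val.isCompact_preimage hK using 1
  ext y
  simp [horocycleHull, eq_comm]

theorem tendsto_of_coord_eq {y : ℕ → T.Y} {z : T.Y} (h : ∀ n, (y n).1 n = z.1 n) :
    Tendsto y atTop (𝓝 z) := by
  rw [isClosedEmbedding_val.isInducing.tendsto_nhds_iff, tendsto_pi_nhds]
  refine fun m => tendsto_const_nhds.congr' ?_
  filter_upwards [eventually_ge_atTop m] with n hn
  exact (by rw [← cover_coord z hn, ← h n, cover_coord _ hn] : z.1 m = (y n).1 m)

theorem isMinimalSet_horocycleHull {x : T.Y} {ℓ : ℝ} (h : (base x).HasPeriod ℓ) :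
    IsMinimalSet (horocycleHull x) := by
  refine ⟨⟨x, mem_horocycleHull_self x⟩, (isCompact_horocycleHull h).isClosed,
    fun s y hy => horocycle_mem_horocycleHull hy s, ?_⟩
  rintro N hN ⟨y, hy⟩ hcl hinv
  refine hN.antisymm fun z hz => ?_
  have : ∀ n, ∃ s, (y.1 n).horocycle s = z.1 n := fun n => by
    obtain ⟨s, hs⟩ := hN hy n
    obtain ⟨t, ht⟩ := hz n
    exact ⟨t - s, by rw [hs, ht, ← UnitTangent.horocycle_add, sub_add_cancel]⟩
  -- Flowing `y` for time `s n` reaches `z` at level `n`, so these points of the orbit converge to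
  -- `z`.
  choose s hs using this
  exact hcl.mem_of_tendsto (tendsto_of_coord_eq (y := fun n => horocycle (s n) y) hs)
    (Eventually.of_forall fun n => hinv (s n) hy)

theorem isMinimalOver_horocycleHull {x : T.Y} {ℓ : ℝ} (h : (base x).HasPeriod ℓ) :
    IsMinimalOver ℓ (horocycleHull x) := by
  refine ⟨isCompact_horocycleHull h, isMinimalSet_horocycleHull h, base x, h, ?_⟩
  ext y
  constructor
  · rintro ⟨z, hz, rfl⟩
    obtain ⟨s, hs⟩ := hz 0
    exact ⟨s, hs.symm⟩
  · rintro ⟨s, rfl⟩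
    exact ⟨_, horocycle_mem_horocycleHull (mem_horocycleHull_self x) s, rfl⟩

theorem IsMinimalOver.hasPeriod {ℓ : ℝ} {M : Set T.Y} (hM : IsMinimalOver ℓ M) {x : T.Y}
    (hx : x ∈ M) : (base x).HasPeriod ℓ := by
  obtain ⟨-, -, y, hy, himg⟩ := hM
  obtain ⟨s, hs⟩ : base x ∈ range fun s => y.horocycle s := himg ▸ mem_image_of_mem _ hx
  rw [← hs]
  exact hy.horocycle s

/-- Both sets are minimal and contain `x`, so each equals their intersection. -/
theorem IsMinimalOver.eq_horocycleHull {ℓ : ℝ} {M : Set T.Y} (hM : IsMinimalOver ℓ M) {x : T.Y}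
    (hx : x ∈ M) : M = horocycleHull x := by
  have hper := hM.hasPeriod hx
  have hL := isMinimalSet_horocycleHull hper
  obtain ⟨-, ⟨-, hcl, hinv, hmin⟩, -⟩ := hM
  have hne : (M ∩ horocycleHull x).Nonempty := ⟨x, hx, mem_horocycleHull_self x⟩
  have hc := hcl.inter hL.2.1
  have hi : IsInvariant horocycle (M ∩ horocycleHull x) :=
    fun t y hy => ⟨hinv t hy.1, hL.2.2.1 t hy.2⟩
  exact (hmin _ inter_subset_left hne hc hi).symm.trans (hL.2.2.2 _ inter_subset_right hne hc hi)

/-! ### Minimal sets indexed by a period and a cuspidal end -/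

/-- The points over a horocycle of period `ℓ` that correspond to `ξ`. -/
def pointsOver (ℓ : ℝ) (ξ : T.YHat) : Set T.Y :=
  {x | (base x).HasPeriod ℓ ∧ CorrespondsTo x ξ}

theorem CorrespondsTo.horocycle {x : T.Y} {ξ : T.YHat} (h : CorrespondsTo x ξ) (s : ℝ) :
    CorrespondsTo (horocycle s x) ξ := fun n => by
  obtain ⟨κ, hκ, hx⟩ := h n
  exact ⟨κ, hκ, hx.horocycle s⟩

theorem CorrespondsTo.geodesic {x : T.Y} {ξ : T.YHat} (h : CorrespondsTo x ξ) (t : ℝ) :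
    CorrespondsTo (geodesic t x) ξ := fun n => by
  obtain ⟨κ, hκ, hx⟩ := h n
  exact ⟨κ, hκ, hx.geodesic t⟩

theorem CorrespondsTo.unique {x : T.Y} {ξ η : T.YHat} (h : CorrespondsTo x ξ)
    (h' : CorrespondsTo x η) : ξ = η := by
  refine Subtype.ext (funext fun n => ?_)
  obtain ⟨κ, hκ, hx⟩ := h n
  obtain ⟨κ', hκ', hx'⟩ := h' n
  rw [hκ, hκ', hx.unique hx']

theorem CorrespondsTo.mem_cuspidalEnds {x : T.Y} {ξ : T.YHat} (h : CorrespondsTo x ξ) :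
    ξ ∈ T.cuspidalEnds := by
  rintro ⟨y, rfl⟩
  obtain ⟨κ, hκ, -⟩ := h 0
  exact Compactification.noConfusion rfl (heq_of_eq hκ)

theorem CorrespondsTo.tendsto_geodesic {x : T.Y} {ξ : T.YHat} (h : CorrespondsTo x ξ) :
    Tendsto (fun t : ℝ => toYHat (CoveringTower.geodesic t x)) atTop (𝓝 ξ) := by
  refine tendsto_subtype_rng.2 (tendsto_pi_nhds.2 fun n => ?_)
  obtain ⟨κ, hκ, hx⟩ := h n
  rw [hκ]
  exact hx.tendsto_geodesic

/-- Coverings send points to points and cusps to cusps, so one coordinate in a unit tangent bundle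
would force all of them there. -/
theorem exists_cusp_of_mem_cuspidalEnds {ξ : T.YHat} (h : ξ ∈ T.cuspidalEnds) (n : ℕ) :
    ∃ κ, ξ.1 n = .cusp κ := by
  by_contra! hn
  apply h
  have h0 : ∃ x, ξ.1 0 = .point x := by
    have key : ∀ n, (∃ x, ξ.1 n = .point x) → ∃ x, ξ.1 0 = .point x := by
      intro n
      induction n with
      | zero => exact id
      | succ n ih =>
        rintro ⟨x, hx⟩
        exact ih ⟨_, by rw [← ξ.2 n, hx]; rfl⟩
    refine key n ?_
    cases hξ : ξ.1 n with
    | point x => exact ⟨x, rfl⟩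
    | cusp κ => exact absurd hξ (hn κ)
  have hall : ∀ n, ∃ x, ξ.1 n = .point x := by
    intro n
    induction n with
    | zero => exact h0
    | succ n ih =>
      obtain ⟨x, hx⟩ := ih
      cases hξ : ξ.1 (n + 1) with
      | point x => exact ⟨x, rfl⟩
      | cusp κ =>
        have := ξ.2 n
        rw [hξ, hx] at this
        exact Compactification.noConfusion rfl (heq_of_eq this)
  choose x hx using hall
  refine ⟨⟨x, fun n => ?_⟩, Subtype.ext (funext fun n => (hx n).symm)⟩
  have := ξ.2 n
  rw [hx, hx] at this
  exact Compactification.point.inj this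

theorem exists_correspondsTo {x : T.Y} {ℓ : ℝ} (h : (base x).HasPeriod ℓ) :
    ∃ ξ ∈ T.cuspidalEnds, CorrespondsTo x ξ := by
  have (n : ℕ) : ∃ κ, PointsTo (x.1 n) κ :=
    PointsTo.exists_of_hasPeriod (hasPeriod_coord h n).choose_spec.2
  choose κ hκ using this
  have hc : CorrespondsTo x ⟨fun n => .cusp (κ n), fun n => congrArg Compactification.cusp
      (((hκ (n + 1)).cover (T.le n)).unique (by rw [x.2 n]; exact hκ n))⟩ :=
    fun n => ⟨κ n, rfl, hκ n⟩
  exact ⟨_, hc.mem_cuspidalEnds, hc⟩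

theorem pointsOver_nonempty {ξ : T.YHat} (hξ : ξ ∈ T.cuspidalEnds) {ℓ : ℝ} (hℓ : 0 < ℓ) :
    (pointsOver ℓ ξ).Nonempty := by
  choose κ hκ using exists_cusp_of_mem_cuspidalEnds hξ
  have hcover (n : ℕ) : Cusp.cover (T.le n) (κ (n + 1)) = κ n := by
    have := ξ.2 n
    rw [hκ, hκ] at this
    exact Compactification.cusp.inj this
  obtain ⟨x₀, hx₀, hper⟩ : ∃ x : UnitTangent (T.Γ 0), PointsTo x (κ 0) ∧ x.HasPeriod ℓ := by
    obtain ⟨x, hx⟩ := PointsTo.exists_pointsTo (κ 0)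
    obtain ⟨r, hr⟩ := hx.exists_hasPeriod T.discrete
    -- This time solves `r e^{-t} = ℓ`.
    refine ⟨x.geodesic (-Real.log (ℓ / r)), hx.geodesic _, ?_⟩
    have := hr.geodesic (-Real.log (ℓ / r))
    rwa [neg_neg, Real.exp_log (div_pos hℓ hr.1), mul_div_cancel₀ _ hr.1.ne'] at this
  have step (n : ℕ) (x : {x : UnitTangent (T.Γ n) // PointsTo x (κ n)}) :
      ∃ y : {x : UnitTangent (T.Γ (n + 1)) // PointsTo x (κ (n + 1))},
        UnitTangent.cover (T.le n) y = x := by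
    obtain ⟨y, hy, hy'⟩ := PointsTo.exists_lift (T.le n) (x := x.1) (κ' := κ (n + 1))
      (by rw [hcover]; exact x.2)
    exact ⟨⟨y, hy'⟩, hy⟩
  choose lift hlift using step
  let x : ∀ n, {x : UnitTangent (T.Γ n) // PointsTo x (κ n)} := fun n =>
    Nat.rec ⟨x₀, hx₀⟩ lift n
  exact ⟨⟨fun n => (x n).1, fun n => hlift n (x n)⟩, hper, fun n => ⟨κ n, hκ n, (x n).2⟩⟩

theorem pointsOver_eq_horocycleHull {x : T.Y} {ξ : T.YHat} {ℓ : ℝ} (hx : x ∈ pointsOver ℓ ξ) :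
    pointsOver ℓ ξ = horocycleHull x := by
  ext y
  constructor
  · intro hy n
    obtain ⟨κ, hκ, hxκ⟩ := hx.2 n
    obtain ⟨κ', hκ', hyκ⟩ := hy.2 n
    rw [hκ] at hκ'
    obtain rfl := Compactification.cusp.inj hκ'
    obtain ⟨t, s, hts⟩ := hxκ.exists_eq_horocycle_geodesic hyκ
    have h0 : base y = ((base x).geodesic t).horocycle s :=
      coord_eq_horocycle_of_le (x := geodesic t x) n.zero_le hts
    have hper := (hx.1.geodesic t).horocycle s
    rw [← h0] at hper
    -- Both base points have period `ℓ`, while `g_t` rescales it by `e^{-t}`; hence `t = 0` and only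
    -- a horocyclic translation remains.
    have ht := hper.unique hy.1
    rw [mul_eq_left₀ hx.1.1.ne', Real.exp_eq_one_iff, neg_eq_zero] at ht
    rw [ht, UnitTangent.geodesic_zero] at hts
    exact ⟨s, hts⟩
  · intro hy
    refine ⟨(isMinimalOver_horocycleHull hx.1).hasPeriod hy, fun n => ?_⟩
    obtain ⟨κ, hκ, hxκ⟩ := hx.2 n
    obtain ⟨s, hs⟩ := hy n
    exact ⟨κ, hκ, hs ▸ hxκ.horocycle s⟩

theorem isMinimalOver_pointsOver {ξ : T.YHat} (hξ : ξ ∈ T.cuspidalEnds) {ℓ : ℝ} (hℓ : 0 < ℓ) :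
    IsMinimalOver ℓ (pointsOver ℓ ξ) := by
  obtain ⟨x, hx⟩ := pointsOver_nonempty hξ hℓ
  rw [pointsOver_eq_horocycleHull hx]
  exact isMinimalOver_horocycleHull hx.1

theorem IsMinimalOver.eq_pointsOver {ℓ : ℝ} {M : Set T.Y} (hM : IsMinimalOver ℓ M) {x : T.Y}
    (hx : x ∈ M) {ξ : T.YHat} (h : CorrespondsTo x ξ) : M = pointsOver ℓ ξ := by
  rw [pointsOver_eq_horocycleHull (x := x) ⟨hM.hasPeriod hx, h⟩, hM.eq_horocycleHull hx]

theorem IsMinimalOver.pos {ℓ : ℝ} {M : Set T.Y} (hM : IsMinimalOver ℓ M) : 0 < ℓ :=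
  hM.2.2.choose_spec.1.1

theorem IsMinimalOver.exists_eq_pointsOver {ℓ : ℝ} {M : Set T.Y} (hM : IsMinimalOver ℓ M) :
    ∃ ξ ∈ T.cuspidalEnds, M = pointsOver ℓ ξ := by
  obtain ⟨x, hx⟩ := hM.2.1.1
  obtain ⟨ξ, hξ, h⟩ := exists_correspondsTo (hM.hasPeriod hx)
  exact ⟨ξ, hξ, hM.eq_pointsOver hx h⟩

theorem pointsOver_injective {ξ η : T.YHat} (hξ : ξ ∈ T.cuspidalEnds) {ℓ ℓ' : ℝ} (hℓ : 0 < ℓ)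
    (h : pointsOver ℓ ξ = pointsOver ℓ' η) : ℓ = ℓ' ∧ ξ = η := by
  obtain ⟨x, hx⟩ := pointsOver_nonempty hξ hℓ
  have hx' := h ▸ hx
  exact ⟨hx.1.unique hx'.1, hx.2.unique hx'.2⟩

theorem geodesic_mem_pointsOver {x : T.Y} {ξ : T.YHat} {ℓ : ℝ} (h : x ∈ pointsOver ℓ ξ) (t : ℝ) :
    geodesic t x ∈ pointsOver (ℓ * Real.exp (-t)) ξ :=
  ⟨h.1.geodesic t, h.2.geodesic t⟩

theorem geodesic_image_pointsOver (t ℓ : ℝ) (ξ : T.YHat) :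
    geodesic t '' pointsOver ℓ ξ = pointsOver (ℓ * Real.exp (-t)) ξ := by
  ext y
  constructor
  · rintro ⟨x, hx, rfl⟩
    exact geodesic_mem_pointsOver hx t
  · intro hy
    refine ⟨geodesic (-t) y, ?_, by rw [← geodesic_add, add_neg_cancel, geodesic_zero]⟩
    have := geodesic_mem_pointsOver hy (-t)
    rwa [mul_assoc, ← Real.exp_add, add_neg_cancel, Real.exp_zero, mul_one] at this

theorem mem_geodesicFamily_pointsOver {ℓ : ℝ} (hℓ : 0 < ℓ) {ξ : T.YHat} {M : Set T.Y} :
    M ∈ geodesicFamily (pointsOver ℓ ξ) ↔ ∃ ℓ' > 0, M = pointsOver ℓ' ξ := by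
  constructor
  · rintro ⟨t, rfl⟩
    exact ⟨_, mul_pos hℓ (Real.exp_pos _), geodesic_image_pointsOver t ℓ ξ⟩
  · rintro ⟨r, hr, rfl⟩
    refine ⟨-Real.log (r / ℓ), ?_⟩
    simp only [geodesic_image_pointsOver]
    rw [neg_neg, Real.exp_log (div_pos hr hℓ), mul_div_cancel₀ _ hℓ.ne']

theorem geodesicFamily_pointsOver_eq {ℓ ℓ' : ℝ} (hℓ : 0 < ℓ) (hℓ' : 0 < ℓ') (ξ : T.YHat) :
    geodesicFamily (pointsOver ℓ ξ) = geodesicFamily (pointsOver ℓ' ξ) := by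
  ext M
  rw [mem_geodesicFamily_pointsOver hℓ, mem_geodesicFamily_pointsOver hℓ']

end CoveringTower

/-! ### Odometers -/

namespace FinitePermutationSystem

variable (O : FinitePermutationSystem)

theorem isClosedEmbedding_val :
    @Topology.IsClosedEmbedding O.Z (∀ n, O.F n) _ (@Pi.topologicalSpace ℕ O.F fun _ => ⊥)
      fun z => z.1 := by
  let (n : ℕ) : TopologicalSpace (O.F n) := ⊥
  have (n : ℕ) : DiscreteTopology (O.F n) := ⟨rfl⟩
  have hc : IsClosed {z : ∀ n, O.F n | ∀ n, O.q n (z (n + 1)) = z n} := by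
    have : {z : ∀ n, O.F n | ∀ n, O.q n (z (n + 1)) = z n} =
        ⋂ n, {z | O.q n (z (n + 1)) = z n} := by ext; simp
    rw [this]
    exact isClosed_iInter fun n => isClosed_eq
      (continuous_of_discreteTopology.comp (continuous_apply _)) (continuous_apply _)
  exact hc.isClosedEmbedding_subtypeVal

instance compactSpace_Z : CompactSpace O.Z := by
  let (n : ℕ) : TopologicalSpace (O.F n) := ⊥
  have := O.finite
  exact O.isClosedEmbedding_val.compactSpace

theorem continuous_comp_coord {α : Type*} [TopologicalSpace α] (n : ℕ) (f : O.F n → α) :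
    Continuous fun z : O.Z => f (z.1 n) := by
  let (n : ℕ) : TopologicalSpace (O.F n) := ⊥
  have (n : ℕ) : DiscreteTopology (O.F n) := ⟨rfl⟩
  exact continuous_of_discreteTopology.comp
    ((continuous_apply n).comp O.isClosedEmbedding_val.continuous)

theorem tendsto_of_coord_eq {O : FinitePermutationSystem} {y : ℕ → O.Z} {z : O.Z}
    (h : ∀ n, ∀ m ≤ n, (y n).1 m = z.1 m) : Tendsto y atTop (𝓝 z) := by
  let (n : ℕ) : TopologicalSpace (O.F n) := ⊥
  rw [O.isClosedEmbedding_val.isInducing.tendsto_nhds_iff, tendsto_pi_nhds]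
  refine fun m => tendsto_const_nhds.congr' ?_
  filter_upwards [eventually_ge_atTop m] with n hn
  exact (h n m hn).symm

/-- The rotations by `1` of the cyclic groups `ℤ / pₙ`, where `pₙ` divides `pₙ₊₁`. -/
def cyclic (p : ℕ → ℕ) (hpos : ∀ n, 0 < p n) (hdvd : ∀ n, p n ∣ p (n + 1)) :
    FinitePermutationSystem where
  F n := ZMod (p n)
  finite n := haveI : NeZero (p n) := ⟨(hpos n).ne'⟩; inferInstance
  perm n := Equiv.addRight 1
  q n := ZMod.castHom (hdvd n) (ZMod (p n))
  q_surjective n := ZMod.castHom_surjective (hdvd n)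
  comm n a := by
    change ZMod.castHom (hdvd n) (ZMod (p n)) a + 1 = ZMod.castHom (hdvd n) (ZMod (p n)) (a + 1)
    rw [map_add, map_one]

variable {p : ℕ → ℕ} {hpos : ∀ n, 0 < p n} {hdvd : ∀ n, p n ∣ p (n + 1)}

/-- A coordinate of a point of the limit of cyclic groups. -/
def cyclicCoord (z : (cyclic p hpos hdvd).Z) (n : ℕ) : ZMod (p n) := z.1 n

/-- The integer representative of a coordinate of a point of the limit of cyclic groups. -/
def cyclicRep (z : (cyclic p hpos hdvd).Z) (n : ℕ) : ℤ := (cyclicCoord z n).cast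

theorem cyclicRep_cast (z : (cyclic p hpos hdvd).Z) (n : ℕ) :
    ((cyclicRep z n : ℤ) : ZMod (p n)) = cyclicCoord z n := ZMod.intCast_zmod_cast _

theorem castHom_cyclicCoord (z : (cyclic p hpos hdvd).Z) (n : ℕ) :
    ZMod.castHom (hdvd n) (ZMod (p n)) (cyclicCoord z (n + 1)) = cyclicCoord z n := z.2 n

theorem dvd_of_dvd_succ (hdvd : ∀ n, p n ∣ p (n + 1)) {m n : ℕ} (h : m ≤ n) : p m ∣ p n := by
  induction n, h using Nat.le_induction with
  | base => exact dvd_rfl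
  | succ n _ ih => exact ih.trans (hdvd n)

/-- The integer representatives at different levels may differ, but the one at level `n` serves
modulo every earlier `pₘ`. -/
theorem cyclicRep_cast_of_le (z : (cyclic p hpos hdvd).Z) {m n : ℕ} (h : m ≤ n) :
    ((cyclicRep z n : ℤ) : ZMod (p m)) = cyclicCoord z m := by
  induction n, h using Nat.le_induction with
  | base => exact cyclicRep_cast z m
  | succ n hmn ih =>
    have hd := dvd_of_dvd_succ hdvd hmn
    rw [← ih, ZMod.intCast_eq_intCast_iff]
    refine Int.ModEq.of_dvd (Int.natCast_dvd_natCast.2 hd) ((ZMod.intCast_eq_intCast_iff _ _ _).1 ?_)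
    rw [cyclicRep_cast, ← castHom_cyclicCoord z n, ← cyclicRep_cast z (n + 1), map_intCast]

theorem cyclicCoord_limitMap_zpow (z : (cyclic p hpos hdvd).Z) (k : ℤ) (n : ℕ) :
    cyclicCoord (((cyclic p hpos hdvd).limitMap ^ k) z) n = cyclicCoord z n + k := by
  have h1 (z : (cyclic p hpos hdvd).Z) :
      cyclicCoord ((cyclic p hpos hdvd).limitMap z) n = cyclicCoord z n + 1 := rfl
  induction k with
  | zero => simp
  | succ k ih =>
    rw [add_comm, zpow_add, Equiv.Perm.mul_apply, zpow_one, h1, ih]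
    push_cast; ring
  | pred k ih =>
    -- The backward step is obtained by applying the forward rule to the earlier point of the orbit.
    have h2 := h1 (((cyclic p hpos hdvd).limitMap ^ (-(k : ℤ) - 1)) z)
    rw [← Equiv.Perm.mul_apply, ← zpow_one_add, add_sub_cancel, ih] at h2
    rw [← sub_eq_iff_eq_add.2 h2]
    push_cast; ring

/-- Rotating `z` by the difference of integer representatives at level `n` makes it agree with `w`
up to that level. -/
theorem cyclic_isMinimal : (cyclic p hpos hdvd).IsMinimal := fun z w => by
  refine mem_closure_of_tendsto (f := fun n : ℕ =>
    ((cyclic p hpos hdvd).limitMap ^ (cyclicRep w n - cyclicRep z n)) z)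
    (tendsto_of_coord_eq (fun n m h => ?_)) (Eventually.of_forall fun n => mem_range_self _)
  refine (cyclicCoord_limitMap_zpow z _ m).trans (Eq.trans (b := cyclicCoord w m) ?_ rfl)
  rw [Int.cast_sub, cyclicRep_cast_of_le z h, cyclicRep_cast_of_le w h, add_sub_cancel]

/-- Subtracting a multiple of `ℓ` from the time shows that the compact set `Z × [0, ℓ]` covers the
suspension. -/
theorem compactSpace_suspension {ℓ : ℝ} (hℓ : 0 < ℓ) : CompactSpace (O.Suspension ℓ) := by
  have hc : Continuous fun q : O.Z × ℝ => Suspension.mk O ℓ q.1 q.2 := continuous_quotient_mk'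
  rw [← isCompact_univ_iff]
  convert (isCompact_univ.prod (isCompact_Icc (a := 0) (b := ℓ))).image hc
  refine (eq_univ_of_forall fun q => ?_).symm
  induction q using Quotient.inductionOn with
  | _ q =>
    obtain ⟨z, s⟩ := q
    refine ⟨((O.limitMap ^ ⌊s / ℓ⌋) z, s - ⌊s / ℓ⌋ * ℓ), ⟨mem_univ _, ?_, ?_⟩, ?_⟩
    · exact sub_nonneg.2 ((le_div_iff₀ hℓ).1 (Int.floor_le _))
    · have := (div_le_iff₀ hℓ).1 (Int.lt_floor_add_one (s / ℓ)).le
      change s - _ ≤ ℓ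
      linarith
    · refine Quotient.sound ((O.suspensionSetoid ℓ).symm ⟨⌊s / ℓ⌋, rfl, ?_⟩)
      simp

end FinitePermutationSystem

/-! ### Minimal sets over closed horocycles as suspensions of odometers -/

namespace CoveringTower

open FinitePermutationSystem UnitTangent

variable {T : CoveringTower} {x : T.Y} {ℓ : ℝ} {p : ℕ → ℕ}

theorem horocycle_coord_eq_iff (hℓ : 0 < ℓ) (hp : ∀ n, (x.1 n).HasPeriod (p n * ℓ)) (n : ℕ) (s : ℝ)
    (a b : ℤ) : (x.1 n).horocycle (s + a * ℓ) = (x.1 n).horocycle (s + b * ℓ) ↔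
      (a : ZMod (p n)) = b := by
  rw [horocycle_eq_iff, (hp n).horocycle_eq_self_iff, eq_comm, ZMod.intCast_eq_intCast_iff_dvd_sub]
  refine exists_congr fun k => ?_
  have h : s + a * ℓ - (s + b * ℓ) - k * (p n * ℓ) = ((a - b - p n * k : ℤ) : ℝ) * ℓ := by
    push_cast; ring
  rw [← sub_eq_zero, h, mul_eq_zero_iff_right hℓ.ne', Int.cast_eq_zero, sub_eq_zero]

theorem period_dvd (hℓ : 0 < ℓ) (hp : ∀ n, (x.1 n).HasPeriod (p n * ℓ)) {m n : ℕ} (h : m ≤ n) :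
    p m ∣ p n := by
  have h0 := (horocycle_coord_eq_iff hℓ hp n 0 (p n) 0).2 (by simp)
  have h1 : (x.1 m).horocycle (0 + (p n : ℤ) * ℓ) = (x.1 m).horocycle (0 + (0 : ℤ) * ℓ) := by
    refine coord_eq_horocycle_of_le (y := horocycle (0 + (p n : ℤ) * ℓ) x) h h0
  simpa [ZMod.natCast_eq_zero_iff] using (horocycle_coord_eq_iff hℓ hp m 0 (p n) 0).1 h1

theorem period_pos (hℓ : 0 < ℓ) (hp : ∀ n, (x.1 n).HasPeriod (p n * ℓ)) (n : ℕ) : 0 < p n := by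
  have := pos_of_mul_pos_left (hp n).1 hℓ.le
  exact_mod_cast this

/-- The class of `(z, s)` goes to the point whose coordinate at level `m` is `xₘ` flowed for time `s
+ zₘ ℓ`. The fibres of this map are the suspension classes, and a continuous bijection from a
compact space to a Hausdorff one is a homeomorphism. The subsequence `φ` allows repeated periods to
be skipped. -/
theorem exists_suspendsTo (hℓ : 0 < ℓ) (hp : ∀ n, (x.1 n).HasPeriod (p n * ℓ))
    (h0 : p 0 = 1) {φ : ℕ → ℕ} (hφ : StrictMono φ) :
    (cyclic (p ∘ φ) (fun _ => period_pos hℓ hp _)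
      (fun n => period_dvd hℓ hp (hφ n.lt_succ_self).le)).SuspendsTo ℓ (horocycleHull x) := by
  set hpos : ∀ n, 0 < (p ∘ φ) n := fun _ => period_pos hℓ hp _
  set hdvd : ∀ n, (p ∘ φ) n ∣ (p ∘ φ) (n + 1) :=
    fun n => period_dvd hℓ hp (hφ n.lt_succ_self).le
  set O := cyclic (p ∘ φ) hpos hdvd
  have hcast {m n : ℕ} (h : p m ∣ p n) {a b : ℤ} (hab : (a : ZMod (p n)) = b) :
      (a : ZMod (p m)) = b := by
    rw [ZMod.intCast_eq_intCast_iff] at hab ⊢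
    exact hab.of_dvd (Int.natCast_dvd_natCast.2 h)
  have hrep (z : O.Z) {m n : ℕ} (h : m ≤ n) :
      ((cyclicRep z n : ℤ) : ZMod (p (φ m))) = (cyclicRep z m : ℤ) := by
    rw [cyclicRep_cast z m]
    exact cyclicRep_cast_of_le z h
  -- The integer used at level `m` is known modulo `p (φ m)`, which is enough because `m ≤ φ m`
  -- gives `p m ∣ p (φ m)`.
  let f : O.Z × ℝ → T.Y := fun q =>
    ⟨fun m => (x.1 m).horocycle (q.2 + cyclicRep q.1 m * ℓ), fun m => by
      refine (cover_translate (T.le m) _ _).trans ?_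
      rw [x.2 m]
      refine (horocycle_coord_eq_iff hℓ hp m q.2 _ _).2 ?_
      exact hcast (period_dvd hℓ hp (hφ.le_apply)) (hrep q.1 m.le_succ)⟩
  have hf (q : O.Z × ℝ) (m : ℕ) :
      (f q).1 m = (x.1 m).horocycle (q.2 + cyclicRep q.1 m * ℓ) := rfl
  have hfc : Continuous f := by
    rw [isClosedEmbedding_val.isInducing.continuous_iff]
    refine continuous_pi fun m => (UnitTangent.continuous_horocycle (x.1 m)).comp ?_
    have hm : Continuous fun z : O.Z => (cyclicRep z m : ℝ) :=
      O.continuous_comp_coord m fun a => ((ZMod.cast (show ZMod (p (φ m)) from a) : ℤ) : ℝ)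
    exact continuous_snd.add ((hm.comp continuous_fst).mul continuous_const)
  have hker (q q' : O.Z × ℝ) : O.suspensionSetoid ℓ q q' ↔ f q = f q' := by
    constructor
    · rintro ⟨k, hk, hk'⟩
      refine Y_ext fun m => ?_
      rw [hf, hf, hk']
      have : q'.2 + k * ℓ + cyclicRep q.1 m * ℓ = q'.2 + ((k + cyclicRep q.1 m : ℤ) : ℝ) * ℓ := by
        push_cast; ring
      rw [this, horocycle_coord_eq_iff hℓ hp]
      refine hcast (n := φ m) (period_dvd hℓ hp (hφ.le_apply)) ?_
      have h1 : cyclicCoord ((O.limitMap ^ k) q.1) m = _ := cyclicCoord_limitMap_zpow q.1 k m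
      rw [← hk, ← cyclicRep_cast, ← cyclicRep_cast, add_comm] at h1
      rw [Int.cast_add]
      exact h1.symm
    · intro h
      have hq (m : ℕ) := (hf q m).symm.trans ((congrArg (fun y : T.Y => y.1 m) h).trans (hf q' m))
      -- As `p 0 = 1`, the base circle has length `ℓ` and determines the real time modulo `ℓ`.
      obtain ⟨k, hk⟩ : ∃ k : ℤ, q.2 = q'.2 + k * ℓ := by
        have := hq 0
        rw [horocycle_eq_iff, (hp 0).horocycle_eq_self_iff, h0] at this
        obtain ⟨k, hk⟩ := this
        refine ⟨k - cyclicRep q.1 0 + cyclicRep q'.1 0, ?_⟩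
        push_cast at hk ⊢
        linarith
      refine ⟨k, Subtype.ext (funext fun n => ?_), hk⟩
      refine Eq.trans (b := cyclicCoord q'.1 n) rfl
        (Eq.trans ?_ (cyclicCoord_limitMap_zpow q.1 k n).symm)
      -- The `n`-th coordinate of `z` lives modulo `p (φ n)`, so it is recovered from level `φ n` of
      -- the tower, not level `n`.
      have h1 := hq (φ n)
      have : q'.2 + k * ℓ + cyclicRep q.1 (φ n) * ℓ =
        q'.2 + ((k + cyclicRep q.1 (φ n) : ℤ) : ℝ) * ℓ := by push_cast; ring
      rw [hk, this, horocycle_coord_eq_iff hℓ hp, Int.cast_add, hrep q.1 hφ.le_apply,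
        hrep q'.1 hφ.le_apply] at h1
      rw [← cyclicRep_cast, ← cyclicRep_cast, add_comm]
      exact h1.symm
  have hsurj (y : T.Y) (hy : y ∈ horocycleHull x) : ∃ q, f q = y := by
    obtain ⟨s, hs⟩ := hy 0
    -- With `s` fixed by the base coordinate, the time at every level is `s` plus a multiple of `ℓ`;
    -- these multiples form the odometer coordinate.
    have (n : ℕ) : ∃ k : ℤ, y.1 n = (x.1 n).horocycle (s + k * ℓ) := by
      obtain ⟨r, hr⟩ := hy n
      have h1 := hs.symm.trans (coord_eq_horocycle_of_le n.zero_le hr)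
      rw [eq_comm, horocycle_eq_iff, (hp 0).horocycle_eq_self_iff, h0] at h1
      obtain ⟨k, hk⟩ := h1
      refine ⟨k, hr.trans (congrArg (fun r => (x.1 n).horocycle r) ?_)⟩
      push_cast at hk
      linarith
    choose k hk using this
    have hcomp {m n : ℕ} (h : m ≤ n) : (k n : ZMod (p m)) = k m :=
      (horocycle_coord_eq_iff hℓ hp m s _ _).1
        ((coord_eq_horocycle_of_le h (hk n)).symm.trans (hk m))
    let z : O.Z := ⟨fun n => (k (φ n) : ZMod (p (φ n))), fun n =>
      (map_intCast (ZMod.castHom (hdvd n) (ZMod (p (φ n)))) _).trans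
        (hcomp (hφ n.lt_succ_self).le)⟩
    refine ⟨(z, s), Y_ext fun m => ?_⟩
    rw [hf, hk, horocycle_coord_eq_iff hℓ hp]
    exact (hcast (period_dvd hℓ hp hφ.le_apply) (cyclicRep_cast z m)).trans (hcomp hφ.le_apply)
  have hmem (q : O.Z × ℝ) : f q ∈ horocycleHull x := fun m => ⟨_, hf q m⟩
  let F : O.Suspension ℓ → horocycleHull x :=
    Quotient.lift (fun q => ⟨f q, hmem q⟩) fun q q' h => Subtype.ext ((hker q q').1 h)
  have hF : Function.Bijective F := by
    constructor
    · intro a b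
      induction a, b using Quotient.inductionOn₂ with
      | _ a b => exact fun h => Quotient.sound ((hker a b).2 (congrArg Subtype.val h))
    · rintro ⟨y, hy⟩
      obtain ⟨q, rfl⟩ := hsurj y hy
      exact ⟨Quotient.mk _ q, rfl⟩
  have hFc : Continuous F := (hfc.subtype_mk hmem).quotient_lift _
  have := O.compactSpace_suspension hℓ
  refine ⟨Continuous.homeoOfEquivCompactToT2 (f := Equiv.ofBijective F hF) hFc, fun z s t => ?_⟩
  change f (z, s + t) = horocycle t (f (z, s))
  refine Y_ext fun m => ?_
  rw [horocycle_coord, hf, hf, ← UnitTangent.horocycle_add]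
  congr 1
  ring

theorem horocycleHull_eq_range_of_bounded (hℓ : 0 < ℓ) (hp : ∀ n, (x.1 n).HasPeriod (p n * ℓ))
    {N : ℕ} (hN : ∀ n, p n ≤ N) :
    ∃ r, 0 < r ∧ horocycle r x = x ∧ horocycleHull x = range fun s : ℝ => horocycle s x := by
  have hpos := period_pos hℓ hp
  -- The factorial is a common multiple of all the `pₙ ≤ N`, so this time returns every coordinate.
  refine ⟨N.factorial * ℓ, mul_pos (Nat.cast_pos.2 N.factorial_pos) hℓ, Y_ext fun n => ?_, ?_⟩
  · obtain ⟨c, hc⟩ := Nat.dvd_factorial (hpos n) (hN n)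
    refine (hp n).horocycle_eq_self_iff.2 ⟨c, ?_⟩
    rw [hc]
    push_cast; ring
  · refine Subset.antisymm (fun y hy => ?_) ?_
    -- Beyond a level where `p` is largest, divisibility makes the periods constant, so a time that
    -- matches at that level matches at all levels.
    · obtain ⟨n, hn⟩ : ∃ n, ∀ m, p m ≤ p n := by
        have hfin : (range p).Finite := (finite_Iic N).subset (by rintro _ ⟨n, rfl⟩; exact hN n)
        obtain ⟨_, ⟨n, rfl⟩, hn⟩ := hfin.exists_maximal (range_nonempty p)
        exact ⟨n, fun m => by
          rcases le_total (p m) (p n) with h | h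
          · exact h
          · exact hn (mem_range_self m) h⟩
      obtain ⟨s, hs⟩ := hy n
      refine ⟨s, Y_ext fun m => ?_⟩
      rcases le_total m n with h | h
      · exact (coord_eq_horocycle_of_le h hs).symm
      · have hmn : p m = p n :=
          (hn m).antisymm (Nat.le_of_dvd (hpos m) (period_dvd hℓ hp h))
        obtain ⟨r, hr⟩ := hy m
        have h1 := hs.symm.trans (coord_eq_horocycle_of_le h hr)
        rw [horocycle_eq_iff, (hp n).horocycle_eq_self_iff, ← hmn,
          ← (hp m).horocycle_eq_self_iff, ← horocycle_eq_iff] at h1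
        exact h1.trans hr.symm
    · rintro _ ⟨s, rfl⟩
      exact horocycle_mem_horocycleHull (mem_horocycleHull_self x) s

theorem exists_odometer (h : (base x).HasPeriod ℓ) :
    ∃ O : FinitePermutationSystem, O.IsMinimal ∧ O.SuspendsTo ℓ (horocycleHull x) ∧
      (O.IsOdometer ∨ ((∃ N : ℕ, ∀ n, Nat.card (O.F n) ≤ N) ∧
        ∃ (y : T.Y) (r : ℝ), 0 < r ∧ horocycle r y = y ∧
          horocycleHull x = range fun s : ℝ => horocycle s y)) := by
  have hℓ := h.1
  choose p _ hp using hasPeriod_coord h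
  have h0 : p 0 = 1 := by
    have := (hp 0).unique h
    rw [mul_eq_right₀ hℓ.ne'] at this
    exact_mod_cast this
  by_cases hb : ∃ N, ∀ n, p n ≤ N
  · obtain ⟨N, hN⟩ := hb
    refine ⟨_, cyclic_isMinimal, exists_suspendsTo hℓ hp h0 strictMono_id, Or.inr ⟨⟨N, fun n => ?_⟩,
      x, horocycleHull_eq_range_of_bounded hℓ hp hN⟩⟩
    exact (Nat.card_zmod _).trans_le (hN n)
  -- Divisibility makes `p` monotone; being unbounded, it tends to infinity.
  · have htop : Tendsto p atTop atTop := by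
      refine tendsto_atTop_atTop_of_monotone
        (fun m n hmn => Nat.le_of_dvd (period_pos hℓ hp n) (period_dvd hℓ hp hmn)) fun N => ?_
      by_contra! hN
      exact hb ⟨N, fun n => (hN n).le⟩
    obtain ⟨φ, hφ, hpφ⟩ := strictMono_subseq_of_tendsto_atTop htop
    refine ⟨_, cyclic_isMinimal, exists_suspendsTo hℓ hp h0 hφ, Or.inl fun m n hmn => ?_⟩
    change Nat.card (ZMod _) < Nat.card (ZMod _)
    rw [Nat.card_zmod, Nat.card_zmod]
    exact hpφ hmn

end CoveringTower

/-! ### The two bijections with the cuspidal ends -/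

namespace CoveringTower

/-- The minimal sets over horocycles of period `1`, indexed by `𝒴̂ - 𝒴`. -/
def cuspidalEndsEquivMinimal (T : CoveringTower) :
    T.cuspidalEnds ≃ {M : Set T.Y // IsMinimalOver 1 M} :=
  Equiv.ofBijective (fun ξ => ⟨pointsOver 1 ξ.1, isMinimalOver_pointsOver ξ.2 one_pos⟩) <| by
    constructor
    · intro ξ η h
      exact Subtype.ext (pointsOver_injective ξ.2 one_pos (congrArg Subtype.val h)).2
    · rintro ⟨M, hM⟩
      obtain ⟨ξ, hξ, rfl⟩ := hM.exists_eq_pointsOver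
      exact ⟨⟨ξ, hξ⟩, rfl⟩

/-- The families of minimal sets over closed horocycles, indexed by `𝒴̂ - 𝒴`. -/
def cuspidalEndsEquivFamilies (T : CoveringTower) : T.cuspidalEnds ≃ T.MinimalFamilies :=
  Equiv.ofBijective (fun ξ => ⟨geodesicFamily (pointsOver 1 ξ.1),
      _, ⟨1, isMinimalOver_pointsOver ξ.2 one_pos⟩, rfl⟩) <| by
    constructor
    · intro ξ η h
      -- The members of the family of `η` are the sets `pointsOver ℓ η`, and each of these
      -- determines its end.
      have hmem : pointsOver 1 ξ.1 ∈ geodesicFamily (pointsOver 1 η.1) := by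
        have : geodesicFamily (pointsOver 1 ξ.1) = geodesicFamily (pointsOver 1 η.1) :=
          congrArg Subtype.val h
        rw [← this]
        exact (mem_geodesicFamily_pointsOver one_pos).2 ⟨1, one_pos, rfl⟩
      obtain ⟨ℓ, -, h⟩ := (mem_geodesicFamily_pointsOver one_pos).1 hmem
      exact Subtype.ext (pointsOver_injective ξ.2 one_pos h).2
    · rintro ⟨_, M, ⟨ℓ, hM⟩, rfl⟩
      obtain ⟨ξ, hξ, rfl⟩ := hM.exists_eq_pointsOver
      exact ⟨⟨ξ, hξ⟩, Subtype.ext (geodesicFamily_pointsOver_eq one_pos hM.pos ξ)⟩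

theorem injective_geodesic_image_pointsOver {T : CoveringTower} {ξ : T.YHat}
    (hξ : ξ ∈ T.cuspidalEnds) {ℓ : ℝ} (hℓ : 0 < ℓ) :
    Function.Injective fun t : ℝ => geodesic t '' pointsOver ℓ ξ := fun s t h => by
  simp only [geodesic_image_pointsOver] at h
  have := (pointsOver_injective hξ (mul_pos hℓ (Real.exp_pos _)) h).1
  simpa [hℓ.ne'] using this

theorem mem_geodesicFamily_pointsOver_iff_correspondsTo {T : CoveringTower} {ξ : T.YHat}
    (hξ : ξ ∈ T.cuspidalEnds) {ℓ : ℝ} (hℓ : 0 < ℓ) {M : Set T.Y} :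
    M ∈ geodesicFamily (pointsOver ℓ ξ) ↔
      IsMinimalOverClosedHorocycle M ∧ ∀ x ∈ M, CorrespondsTo x ξ := by
  rw [mem_geodesicFamily_pointsOver hℓ]
  constructor
  · rintro ⟨r, hr, rfl⟩
    exact ⟨⟨r, isMinimalOver_pointsOver hξ hr⟩, fun x hx => hx.2⟩
  · rintro ⟨⟨r, hM⟩, h⟩
    obtain ⟨x, hx⟩ := hM.2.1.1
    exact ⟨r, hM.pos, hM.eq_pointsOver hx (h x hx)⟩

end CoveringTower

end HorocycleSolenoid

end

open HorocycleSolenoid in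
theorem proposition6p2 (T : CoveringTower) :
    -- the correspondences of the points of `𝒴̂ - 𝒴` with minimal sets and with families
    ∃ (Φ : T.cuspidalEnds ≃ {M : Set T.Y // CoveringTower.IsMinimalOver 1 M})
      (Ψ : T.cuspidalEnds ≃ T.MinimalFamilies),
      -- `Φ ξ` consists of the points over horocycles of period 1 that correspond to `ξ`
      (∀ (ξ : T.cuspidalEnds) (x : T.Y), x ∈ (Φ ξ : Set T.Y) ↔
        (CoveringTower.base x).HasPeriod 1 ∧ CoveringTower.CorrespondsTo x ξ) ∧
      -- `Ψ ξ` is the family of `Φ ξ`, parametrized by the time of the geodesic flow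
      (∀ ξ : T.cuspidalEnds,
        (Ψ ξ : Set (Set T.Y)) = CoveringTower.geodesicFamily (Φ ξ : Set T.Y) ∧
        Function.Injective fun t : ℝ => CoveringTower.geodesic t '' (Φ ξ : Set T.Y)) ∧
      -- `Ψ ξ` consists of all minimal sets over closed horocycles whose points correspond to `ξ`
      (∀ (ξ : T.cuspidalEnds) (M : Set T.Y), M ∈ (Ψ ξ : Set (Set T.Y)) ↔
        CoveringTower.IsMinimalOverClosedHorocycle M ∧
          ∀ x ∈ M, CoveringTower.CorrespondsTo x ξ) ∧
      -- the points of these sets converge to `ξ` in `𝒴̂` under the geodesic flow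
      (∀ (ξ : T.cuspidalEnds), ∀ M ∈ (Ψ ξ : Set (Set T.Y)), ∀ x ∈ M,
        Filter.Tendsto (fun t : ℝ => CoveringTower.toYHat (CoveringTower.geodesic t x))
          Filter.atTop (nhds (ξ : T.YHat))) ∧
      -- each minimal set over a closed horocycle is the suspension of a minimal odometer,
      -- which is finite exactly when the minimal set is a closed horocyclic orbit
      (∀ (ℓ : ℝ) (M : Set T.Y), CoveringTower.IsMinimalOver ℓ M →
        ∃ O : FinitePermutationSystem, O.IsMinimal ∧ O.SuspendsTo ℓ M ∧
          (O.IsOdometer ∨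
            ((∃ N : ℕ, ∀ n, Nat.card (O.F n) ≤ N) ∧
              ∃ (x : T.Y) (p : ℝ), 0 < p ∧ CoveringTower.horocycle p x = x ∧
                M = Set.range fun s : ℝ => CoveringTower.horocycle s x))) := by
  refine ⟨CoveringTower.cuspidalEndsEquivMinimal T, CoveringTower.cuspidalEndsEquivFamilies T,
    fun _ _ => Iff.rfl, fun ξ => ⟨rfl, CoveringTower.injective_geodesic_image_pointsOver ξ.2 one_pos⟩,
    fun ξ M => CoveringTower.mem_geodesicFamily_pointsOver_iff_correspondsTo ξ.2 one_pos,
    fun ξ M hM x hx => ?_, fun ℓ M hM => ?_⟩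
  · exact (((CoveringTower.mem_geodesicFamily_pointsOver_iff_correspondsTo ξ.2 one_pos).1 hM).2
      x hx).tendsto_geodesic
  · obtain ⟨x, hx⟩ := hM.2.1.1
    rw [hM.eq_horocycleHull hx]
    exact CoveringTower.exists_odometer (hM.hasPeriod hx)
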